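/- **Theorem A.** Let $(M,L)$ be an $n$-dimensional $C^\infty$ Finsler manifold: $L:TM\to\mathbb R$ is positive and $C^\infty$ off the zero section, positively homogeneous of degree one on every tangent space, and $g_{ij}=\frac12\dot\partial_i\dot\partial_jL^2$ is positive definite at every nonzero vector. Let $\sigma$ be a $C^\infty$ function and $\beta=b_i(x)y^i$ a $C^\infty$ 1-form on $M$ such that $\overline L=e^{\sigma(x)}L+\beta$ is again a Finsler metric function. Notation (in any local coordinates $x^i$ with induced fibre coordinates $y^i$, sums over repeated indices): $\partial_i=\partial/\partial x^i$, $\dot\partial_i=\partial/\partial y^i$; $(g^{ij})=(g_{ij})^{-1}$; $L_i=\dot\partial_iL$, $L_{ij}=\dot\partial_jL_i$, $L_{ijk}=\dot\partial_kL_{ij}$, $L^i=y^i/L$; $b^i=g^{ij}b_j$. The canonical nonlinear connection of $L$ is $N^i_j=\dot\partial_jG^i$, where $G^i=\frac14g^{ir}(\partial_jg_{rk}+\partial_kg_{rj}-\partial_rg_{jk})y^jy^k$; put $\delta_k=\partial_k-N^r_k\dot\partial_r$. The (horizontal) coefficients of the Cartan connection of $(M,L)$ are $\Gamma^i_{jk}=\frac12g^{ir}(\delta_jg_{rk}+\delta_kg_{rj}-\delta_rg_{jk})$;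 $\overline\Gamma^i_{jk}$ are those of $(M,\overline L)$, and $D^i_{jk}=\overline\Gamma^i_{jk}-\Gamma^i_{jk}$. Let $b_{i|j}=\partial_jb_i-b_r\Gamma^r_{ij}$, $E_{ij}=\frac12(b_{i|j}+b_{j|i})$, $F_{ij}=\frac12(b_{i|j}-b_{j|i})$, $\sigma_i=\partial_i\sigma$, $\sigma^r=g^{ri}\sigma_i$, $\sigma_\beta=\sigma_ib^i$, $\sigma_{ij}=\sigma_iL_j+\sigma_jL_i$, $\mu_{ij}=\sigma_iL_j-\sigma_jL_i$. An index $0$ denotes contraction with $y$ (so $D^r_{0j}=D^r_{ij}y^i$, $F_{i0}=F_{ij}y^j$, $E_{0j}=E_{ij}y^i$, $\sigma_0=\sigma_iy^i$), and $F^r{}_0=g^{ir}F_{i0}$, $F_{\beta0}=F_{i0}b^i$. Then, in every local coordinate system and at every $(x,y)$ with $y\ne0$, $$D^r_{00}=2Le^{-\sigma}F^r{}_0+\frac{L}{\overline L}\bigl(E_{00}-2Le^{-\sigma}F_{\beta0}\bigr)L^r-L^2\sigma^r+\frac{L}{\overline L}\bigl(2Le^{\sigma}\sigma_0+L^2\sigma_\beta\bigr)L^r,$$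 $$D^i_{0j}=L\,g^{ir}G_{rj}+\frac{L}{\overline L}\bigl(G_j-L\,b^rG_{rj}\bigr)L^i,$$ $$D^i_{jk}=L\,g^{ir}H_{rjk}+\frac{L}{\overline L}\bigl(H_{jk}-L\,b^rH_{rjk}\bigr)L^i,$$ where $$G_{ij}=e^{-\sigma}F_{ij}-\tfrac12L_{ijr}D^r_{00}+\tfrac12(\sigma_0L_{ij}-\mu_{ij}),\qquad G_i=E_{0i}-\tfrac12e^{\sigma}L_{ir}D^r_{00}+\tfrac12e^{\sigma}(\sigma_0L_i+\sigma_iL),$$ with $D^r_{00}$ given by the first formula, and $$H_{ijk}=\tfrac12\bigl(L_{jkr}D^r_{0i}-L_{ijr}D^r_{0k}-L_{ikr}D^r_{0j}+\sigma_jL_{ik}+\sigma_kL_{ij}-\sigma_iL_{jk}\bigr),$$ $$H_{ij}=E_{ij}-\tfrac12e^{\sigma}\bigl(L_{ir}D^r_{0j}+L_{jr}D^r_{0i}-\sigma_{ij}\bigr),$$ with $D^r_{0j}$ given by the second formula. Thus the right-hand sides involve only $\sigma$, $b_i$ and the geometry of $(M,L)$. -/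

import Mathlib

open scoped Manifold ContDiff

noncomputable section

/-- The model space `ℝⁿ`. -/
abbrev Rn (n : ℕ) : Type := EuclideanSpace ℝ (Fin n)

namespace Finsler

/-! Local Finsler geometry in coordinates `(x, y)`: scalar fields on (a chart domain of) the tangent
bundle are functions `f x y` of the position `x` and the direction `y`. -/

section Local

variable {n : ℕ}

/-- `∂_i f`: partial derivative with respect to `xⁱ`. -/
def dx (f : Rn n → Rn n → ℝ) (i : Fin n) (x y : Rn n) : ℝ :=
  fderiv ℝ (fun x' => f x' y) x (EuclideanSpace.single i 1)

/-- `∂̇_i f`: partial derivative with respect to `yⁱ`. -/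
def dy (f : Rn n → Rn n → ℝ) (i : Fin n) (x y : Rn n) : ℝ :=
  fderiv ℝ (fun y' => f x y') y (EuclideanSpace.single i 1)

variable (L : Rn n → Rn n → ℝ)

/-- The fundamental tensor `g_ij = ½ ∂̇_i ∂̇_j L²`. -/
def g (i j : Fin n) (x y : Rn n) : ℝ :=
  dy (dy (fun x y => (1 / 2) * L x y ^ 2) j) i x y

/-- The matrix `(g_ij)` at `(x, y)`. -/
def gMatrix (x y : Rn n) : Matrix (Fin n) (Fin n) ℝ := Matrix.of fun i j => g L i j x y

/-- The inverse `g^ij` of the fundamental tensor. -/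
def gInv (i j : Fin n) (x y : Rn n) : ℝ := (gMatrix L x y)⁻¹ i j

/-- `L_i = ∂̇_i L`. -/
def L1 (i : Fin n) : Rn n → Rn n → ℝ := dy L i

/-- `L_ij = ∂̇_j L_i`. -/
def L2 (i j : Fin n) : Rn n → Rn n → ℝ := dy (L1 L i) j

/-- `L_ijk = ∂̇_k L_ij`. -/
def L3 (i j k : Fin n) : Rn n → Rn n → ℝ := dy (L2 L i j) k

/-- `Lⁱ = yⁱ / L`. -/
def Lup (i : Fin n) (x y : Rn n) : ℝ := y i / L x y

/-- The formal Christoffel symbols `γⁱ_jk = ½ g^ir (∂_j g_rk + ∂_k g_rj - ∂_r g_jk)`. -/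
def christoffel (i j k : Fin n) (x y : Rn n) : ℝ :=
  (1 / 2) * ∑ r, gInv L i r x y *
    (dx (g L r k) j x y + dx (g L r j) k x y - dx (g L j k) r x y)

/-- The coefficients `Gⁱ = ½ γⁱ_jk y^j y^k` of the canonical (geodesic) spray. -/
def spray (i : Fin n) (x y : Rn n) : ℝ :=
  (1 / 2) * ∑ j, ∑ k, christoffel L i j k x y * y j * y k

/-- The canonical (Cartan) nonlinear connection `Nⁱ_j = ∂̇_j Gⁱ`. -/
def N (i j : Fin n) (x y : Rn n) : ℝ := dy (spray L i) j x y

/-- The horizontal derivative `δ_k = ∂_k - N^r_k ∂̇_r`. -/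
def delta (f : Rn n → Rn n → ℝ) (k : Fin n) (x y : Rn n) : ℝ :=
  dx f k x y - ∑ r, N L r k x y * dy f r x y

/-- The horizontal coefficients of the Cartan connection,
`Γⁱ_jk = ½ g^ir (δ_j g_rk + δ_k g_rj - δ_r g_jk)`. -/
def cartan (i j k : Fin n) (x y : Rn n) : ℝ :=
  (1 / 2) * ∑ r, gInv L i r x y *
    (delta L (g L r k) j x y + delta L (g L r j) k x y - delta L (g L j k) r x y)

/-! The tensors of a β-conformal change `e^σ L + β`, `β = b_i yⁱ`. They depend on `L`, `σ` and `b`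
only. An index `0` is a contraction with `y`, an index `β` (here `b`) one with `bⁱ`. -/

variable (σ : Rn n → ℝ) (b : Fin n → Rn n → ℝ)

/-- The transformed function `L̄ = e^σ L + b_i yⁱ`. -/
def Lbar (x y : Rn n) : ℝ := Real.exp (σ x) * L x y + ∑ i, b i x * y i

/-- `bⁱ = g^ij b_j`. -/
def bUp (i : Fin n) (x y : Rn n) : ℝ := ∑ j, gInv L i j x y * b j x

/-- The horizontal covariant derivative `b_i|j = δ_j b_i - b_r Γ^r_ij`. -/
def bCov (i j : Fin n) (x y : Rn n) : ℝ :=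
  delta L (fun x _ => b i x) j x y - ∑ r, b r x * cartan L r i j x y

/-- `E_ij = ½ (b_i|j + b_j|i)`. -/
def E (i j : Fin n) (x y : Rn n) : ℝ := (1 / 2) * (bCov L b i j x y + bCov L b j i x y)

/-- `F_ij = ½ (b_i|j - b_j|i)`. -/
def F (i j : Fin n) (x y : Rn n) : ℝ := (1 / 2) * (bCov L b i j x y - bCov L b j i x y)

/-- `E_0j = yⁱ E_ij`. -/
def E0 (j : Fin n) (x y : Rn n) : ℝ := ∑ i, E L b i j x y * y i

/-- `E_00 = yⁱ y^j E_ij`. -/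
def E00 (x y : Rn n) : ℝ := ∑ i, ∑ j, E L b i j x y * y i * y j

/-- `F_i0 = F_ij y^j`. -/
def F0 (i : Fin n) (x y : Rn n) : ℝ := ∑ j, F L b i j x y * y j

/-- `F^r_0 = g^ir F_i0`. -/
def F0Up (r : Fin n) (x y : Rn n) : ℝ := ∑ i, gInv L i r x y * F0 L b i x y

/-- `F_β0 = F_i0 bⁱ`. -/
def Fb0 (x y : Rn n) : ℝ := ∑ i, F0 L b i x y * bUp L b i x y

/-- `σ_i = ∂σ/∂xⁱ`. -/
def σd (i : Fin n) (x : Rn n) : ℝ := fderiv ℝ σ x (EuclideanSpace.single i 1)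

/-- `σ_0 = σ_i yⁱ`. -/
def σ0 (x y : Rn n) : ℝ := ∑ i, σd σ i x * y i

/-- `σ^r = g^ri σ_i`. -/
def σUp (r : Fin n) (x y : Rn n) : ℝ := ∑ i, gInv L r i x y * σd σ i x

/-- `σ_β = σ_i bⁱ`. -/
def σb (x y : Rn n) : ℝ := ∑ i, σd σ i x * bUp L b i x y

/-- `σ_ij = σ_i L_j + σ_j L_i`. -/
def σS (i j : Fin n) (x y : Rn n) : ℝ := σd σ i x * L1 L j x y + σd σ j x * L1 L i x y

/-- `μ_ij = σ_i L_j - σ_j L_i`. -/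
def μA (i j : Fin n) (x y : Rn n) : ℝ := σd σ i x * L1 L j x y - σd σ j x * L1 L i x y

/-- The expression for `D^r_00`:
`2 L e^{-σ} F^r_0 + (L/L̄)(E_00 - 2 L e^{-σ} F_β0) L^r - L² σ^r + (L/L̄)(2 L e^σ σ_0 + L² σ_β) L^r`. -/
def D00 (r : Fin n) (x y : Rn n) : ℝ :=
  2 * L x y * Real.exp (-σ x) * F0Up L b r x y
    + L x y / Lbar L σ b x y
        * (E00 L b x y - 2 * L x y * Real.exp (-σ x) * Fb0 L b x y) * Lup L r x y
    - L x y ^ 2 * σUp L σ r x y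
    + L x y / Lbar L σ b x y
        * (2 * L x y * Real.exp (σ x) * σ0 σ x y + L x y ^ 2 * σb L σ b x y) * Lup L r x y

/-- `G_ij = e^{-σ} F_ij - ½ L_ijr D^r_00 + ½ (σ_0 L_ij - μ_ij)`. -/
def G2 (i j : Fin n) (x y : Rn n) : ℝ :=
  Real.exp (-σ x) * F L b i j x y - (1 / 2) * ∑ r, L3 L i j r x y * D00 L σ b r x y
    + (1 / 2) * (σ0 σ x y * L2 L i j x y - μA L σ i j x y)

/-- `G_i = E_0i - ½ e^σ L_ir D^r_00 + ½ e^σ (σ_0 L_i + σ_i L)`. -/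
def G1 (i : Fin n) (x y : Rn n) : ℝ :=
  E0 L b i x y - (1 / 2) * Real.exp (σ x) * ∑ r, L2 L i r x y * D00 L σ b r x y
    + (1 / 2) * Real.exp (σ x) * (σ0 σ x y * L1 L i x y + σd σ i x * L x y)

/-- The expression for `Dⁱ_0j`: `L Gⁱ_j + (L/L̄)(G_j - L G_βj) Lⁱ`. -/
def D0 (i j : Fin n) (x y : Rn n) : ℝ :=
  L x y * (∑ r, gInv L i r x y * G2 L σ b r j x y)
    + L x y / Lbar L σ b x y
        * (G1 L σ b j x y - L x y * ∑ r, bUp L b r x y * G2 L σ b r j x y) * Lup L i x y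

/-- `H_ijk = ½ (L_jkr D^r_0i - L_ijr D^r_0k - L_ikr D^r_0j + σ_j L_ik + σ_k L_ij - σ_i L_jk)`. -/
def H3 (i j k : Fin n) (x y : Rn n) : ℝ :=
  (1 / 2) * ((∑ r, L3 L j k r x y * D0 L σ b r i x y)
    - (∑ r, L3 L i j r x y * D0 L σ b r k x y)
    - (∑ r, L3 L i k r x y * D0 L σ b r j x y)
    + σd σ j x * L2 L i k x y + σd σ k x * L2 L i j x y - σd σ i x * L2 L j k x y)

/-- `H_ij = E_ij - ½ e^σ (L_ir D^r_0j + L_jr D^r_0i - σ_ij)`. -/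
def H2 (i j : Fin n) (x y : Rn n) : ℝ :=
  E L b i j x y - (1 / 2) * Real.exp (σ x)
    * ((∑ r, L2 L i r x y * D0 L σ b r j x y) + (∑ r, L2 L j r x y * D0 L σ b r i x y)
        - σS L σ i j x y)

/-- The expression for `Dⁱ_jk`: `L Hⁱ_jk + (L/L̄)(H_jk - L H_βjk) Lⁱ`. -/
def Dexpr (i j k : Fin n) (x y : Rn n) : ℝ :=
  L x y * (∑ r, gInv L i r x y * H3 L σ b r j k x y)
    + L x y / Lbar L σ b x y
        * (H2 L σ b j k x y - L x y * ∑ r, bUp L b r x y * H3 L σ b r j k x y) * Lup L i x y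

end Local

/-! Finsler metrics on manifolds. A local coordinate system of `M` is a member `c` of the maximal
`C^∞` atlas; it induces coordinates `(x, y)` on the tangent bundle, the vector with coordinates
`(x, y)` being `yⁱ ∂/∂xⁱ` at the point `c.symm x`. -/

section Manifold

variable {n : ℕ} {M : Type*} [TopologicalSpace M] [ChartedSpace (Rn n) M]

/-- The tangent vector with coordinates `(x, y)` in the coordinate system `c`. -/
def tangentVec (c : OpenPartialHomeomorph M (Rn n)) (x y : Rn n) : TangentBundle (𝓡 n) M :=
  ⟨c.symm x, mfderiv (𝓡 n) (𝓡 n) c.symm x y⟩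

/-- Coordinate expression of a function on the tangent bundle. -/
def inCoord (c : OpenPartialHomeomorph M (Rn n)) (f : TangentBundle (𝓡 n) M → ℝ)
    (x y : Rn n) : ℝ :=
  f (tangentVec c x y)

/-- The components `b_i` of a 1-form in a coordinate system. -/
def formCoord (c : OpenPartialHomeomorph M (Rn n)) (b : ∀ p : M, TangentSpace (𝓡 n) p →L[ℝ] ℝ)
    (i : Fin n) (x : Rn n) : ℝ :=
  b (c.symm x) (mfderiv (𝓡 n) (𝓡 n) c.symm x (EuclideanSpace.single i (1 : ℝ)))

/-- A 1-form is smooth if its components are smooth in all local coordinates. -/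
def IsSmoothOneForm (b : ∀ p : M, TangentSpace (𝓡 n) p →L[ℝ] ℝ) : Prop :=
  ∀ c ∈ IsManifold.maximalAtlas (𝓡 n) ∞ M, ∀ i, ContDiffOn ℝ ∞ (formCoord c b i) c.target

/-- `L` is a Finsler metric function on `M`: positive and smooth off the zero section, positively
homogeneous of degree one on each tangent space, with positive definite fundamental tensor. -/
structure IsFinslerMetric (L : TangentBundle (𝓡 n) M → ℝ) : Prop where
  pos : ∀ (p : M) (v : TangentSpace (𝓡 n) p), v ≠ 0 → 0 < L ⟨p, v⟩
  homogeneous : ∀ (p : M) (v : TangentSpace (𝓡 n) p) (t : ℝ), 0 < t → L ⟨p, t • v⟩ = t * L ⟨p, v⟩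
  smooth : ∀ c ∈ IsManifold.maximalAtlas (𝓡 n) ∞ M,
    ContDiffOn ℝ ∞ (fun q : Rn n × Rn n => inCoord c L q.1 q.2) (c.target ×ˢ {y | y ≠ 0})
  posDef : ∀ c ∈ IsManifold.maximalAtlas (𝓡 n) ∞ M, ∀ x ∈ c.target, ∀ y : Rn n, y ≠ 0 →
    (gMatrix (inCoord c L) x y).PosDef

/-- The β-conformal change `L ↦ L̄ = e^σ L + β`, where `β` is the 1-form `b` seen as a fibrewise
linear function on the tangent bundle. -/
def betaConformalChange (σ : M → ℝ) (b : ∀ p : M, TangentSpace (𝓡 n) p →L[ℝ] ℝ)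
    (L : TangentBundle (𝓡 n) M → ℝ) (v : TangentBundle (𝓡 n) M) : ℝ :=
  Real.exp (σ v.proj) * L v + b v.proj v.snd

/-- The difference tensor `Dⁱ_jk = Γ̄ⁱ_jk - Γⁱ_jk` of the Cartan connections of `L` and `L'` in a
coordinate system. -/
def cartanDiff (L L' : TangentBundle (𝓡 n) M → ℝ) (c : OpenPartialHomeomorph M (Rn n))
    (i j k : Fin n) (x y : Rn n) : ℝ :=
  cartan (inCoord c L') i j k x y - cartan (inCoord c L) i j k x y

end Manifold

end Finsler

end

/-! The change is almost invisible to fibre derivatives: L̄_i = e^σ L_i + b_i and L̄_ij = e^σ L_ij.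
The Cartan connection is metrical and satisfies Γ^s_jk y^j = N^s_k; these two facts make L, L_i and
L_ij horizontally parallel (`delta_L`, `delta_L1`, `delta_L2`). This applies to L and to L̄, and
δ̄_k = δ_k - D^r_0k ∂̇_r (`delta_Lbar`), so comparing the two versions yields linear equations for
L̄_r D^r_ik and for L_jr D^r_ik + L_ir D^r_jk (`L1_Lbar_mul_diffTensor`, `L2_mul_diffTensor_add`).

Because g_ij = L_i L_j + L L_ij, a vector w can be recovered from L_ir w^r and L̄_r w^r
(`eq_of_contractions`); this accounts for the common shape of the three formulas. The required
contractions form a triangular system. Cyclic permutation of indices expresses those of D^r_jk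
through D^r_0j. One contraction with y, combined with the skew part of the first equation, expresses
those of D^r_0j through D^r_00. A second contraction closes the system, since L_ijr y^j = -L_ir, and
determines D^r_00 outright. Solving back gives D^r_0j and then D^r_jk. -/

namespace Finsler

/-! ### Calculus of scalar fields on the slit tangent bundle. -/

section Calculus

variable {n : ℕ} {U : Set (Rn n)} {f h : Rn n → Rn n → ℝ} {x y : Rn n}

/-- Smoothness of a scalar field on the part of the tangent bundle over `U` off the zero section. -/
noncomputable def SmoothOffZero (U : Set (Rn n)) (f : Rn n → Rn n → ℝ) : Prop :=
  ContDiffOn ℝ ∞ (fun q : Rn n × Rn n => f q.1 q.2) (U ×ˢ {y | y ≠ 0})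

/-- The derivative of a scalar field in a direction of the `(x, y)`-space. -/
noncomputable def dirDeriv (f : Rn n → Rn n → ℝ) (v : Rn n × Rn n) (x y : Rn n) : ℝ :=
  fderiv ℝ (fun q : Rn n × Rn n => f q.1 q.2) (x, y) v

theorem prod_mem_nhds_of_ne_zero (hU : IsOpen U) (hx : x ∈ U) (hy : y ≠ 0) :
    U ×ˢ {y : Rn n | y ≠ 0} ∈ nhds (x, y) :=
  (hU.prod isOpen_ne).mem_nhds ⟨hx, hy⟩

theorem SmoothOffZero.contDiffAt (hf : SmoothOffZero U f) (hU : IsOpen U) (hx : x ∈ U)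
    (hy : y ≠ 0) : ContDiffAt ℝ ∞ (fun q : Rn n × Rn n => f q.1 q.2) (x, y) :=
  ContDiffOn.contDiffAt hf (prod_mem_nhds_of_ne_zero hU hx hy)

theorem SmoothOffZero.differentiableAt (hf : SmoothOffZero U f) (hU : IsOpen U) (hx : x ∈ U)
    (hy : y ≠ 0) : DifferentiableAt ℝ (fun q : Rn n × Rn n => f q.1 q.2) (x, y) :=
  (hf.contDiffAt hU hx hy).differentiableAt (by simp)

theorem SmoothOffZero.congr (hf : SmoothOffZero U f)
    (H : ∀ x ∈ U, ∀ y, y ≠ 0 → h x y = f x y) : SmoothOffZero U h :=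
  ContDiffOn.congr hf fun q hq => H q.1 hq.1 q.2 hq.2

theorem SmoothOffZero.add (hf : SmoothOffZero U f) (hh : SmoothOffZero U h) :
    SmoothOffZero U (fun x y => f x y + h x y) :=
  ContDiffOn.add hf hh

theorem SmoothOffZero.sub (hf : SmoothOffZero U f) (hh : SmoothOffZero U h) :
    SmoothOffZero U (fun x y => f x y - h x y) :=
  ContDiffOn.sub hf hh

theorem SmoothOffZero.mul (hf : SmoothOffZero U f) (hh : SmoothOffZero U h) :
    SmoothOffZero U (fun x y => f x y * h x y) :=
  ContDiffOn.mul hf hh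

theorem SmoothOffZero.sum {ι : Type*} {s : Finset ι} {f : ι → Rn n → Rn n → ℝ}
    (hf : ∀ i ∈ s, SmoothOffZero U (f i)) : SmoothOffZero U (fun x y => ∑ i ∈ s, f i x y) :=
  ContDiffOn.sum hf

theorem SmoothOffZero.prod {ι : Type*} {s : Finset ι} {f : ι → Rn n → Rn n → ℝ}
    (hf : ∀ i ∈ s, SmoothOffZero U (f i)) : SmoothOffZero U (fun x y => ∏ i ∈ s, f i x y) :=
  contDiffOn_prod hf

theorem SmoothOffZero.const (a : ℝ) : SmoothOffZero U (fun _ _ => a) :=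
  contDiffOn_const

theorem SmoothOffZero.fibreCoord (i : Fin n) : SmoothOffZero U (fun _ y => y i) := by
  unfold SmoothOffZero
  fun_prop

theorem SmoothOffZero.ofBase {a : Rn n → ℝ} (ha : ContDiffOn ℝ ∞ a U) :
    SmoothOffZero U (fun x _ => a x) :=
  ContDiffOn.comp (t := U) ha contDiff_fst.contDiffOn fun _ hq => hq.1

theorem SmoothOffZero.inv (hf : SmoothOffZero U f) (h0 : ∀ x ∈ U, ∀ y, y ≠ 0 → f x y ≠ 0) :
    SmoothOffZero U (fun x y => (f x y)⁻¹) :=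
  ContDiffOn.inv hf fun q hq => h0 q.1 hq.1 q.2 hq.2

theorem SmoothOffZero.dirDeriv (hf : SmoothOffZero U f) (hU : IsOpen U) (v : Rn n × Rn n) :
    SmoothOffZero U (dirDeriv f v) :=
  (ContDiffOn.fderiv_of_isOpen (m := ∞) hf (hU.prod isOpen_ne) (by simp)).clm_apply
    contDiffOn_const

theorem dx_eq_dirDeriv (hf : SmoothOffZero U f) (hU : IsOpen U) (hx : x ∈ U) (hy : y ≠ 0)
    (i : Fin n) : dx f i x y = dirDeriv f (EuclideanSpace.single i 1, 0) x y := by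
  have h1 := (hf.differentiableAt hU hx hy).hasFDerivAt.comp x
    ((hasFDerivAt_id (𝕜 := ℝ) x).prodMk (hasFDerivAt_const y x))
  have h2 := h1.fderiv
  simp only [dx, dirDeriv]
  change fderiv ℝ ((fun q : Rn n × Rn n => f q.1 q.2) ∘ fun x' => (x', y)) x _ = _
  erw [h2]
  rfl

theorem dy_eq_dirDeriv (hf : SmoothOffZero U f) (hU : IsOpen U) (hx : x ∈ U) (hy : y ≠ 0)
    (i : Fin n) : dy f i x y = dirDeriv f (0, EuclideanSpace.single i 1) x y := by
  have h1 := (hf.differentiableAt hU hx hy).hasFDerivAt.comp y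
    ((hasFDerivAt_const x y).prodMk (hasFDerivAt_id (𝕜 := ℝ) y))
  have h2 := h1.fderiv
  simp only [dy, dirDeriv]
  change fderiv ℝ ((fun q : Rn n × Rn n => f q.1 q.2) ∘ fun y' => (x, y')) y _ = _
  erw [h2]
  rfl

theorem SmoothOffZero.dx (hf : SmoothOffZero U f) (hU : IsOpen U) (i : Fin n) :
    SmoothOffZero U (dx f i) :=
  (hf.dirDeriv hU _).congr fun _ hx _ hy => dx_eq_dirDeriv hf hU hx hy i

theorem SmoothOffZero.dy (hf : SmoothOffZero U f) (hU : IsOpen U) (i : Fin n) :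
    SmoothOffZero U (dy f i) :=
  (hf.dirDeriv hU _).congr fun _ hx _ hy => dy_eq_dirDeriv hf hU hx hy i

/-- The slit region over U is open, so an identity valid throughout it may be differentiated in any
direction. -/
theorem dirDeriv_congr (hU : IsOpen U) (hx : x ∈ U) (hy : y ≠ 0)
    (H : ∀ x ∈ U, ∀ y, y ≠ 0 → f x y = h x y) (v : Rn n × Rn n) :
    dirDeriv f v x y = dirDeriv h v x y := by
  have : (fun q : Rn n × Rn n => f q.1 q.2) =ᶠ[nhds (x, y)] fun q => h q.1 q.2 := by
    filter_upwards [prod_mem_nhds_of_ne_zero hU hx hy] with q hq using H q.1 hq.1 q.2 hq.2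
  rw [dirDeriv, this.fderiv_eq, dirDeriv]

theorem dirDeriv_add (hf : SmoothOffZero U f) (hh : SmoothOffZero U h) (hU : IsOpen U)
    (hx : x ∈ U) (hy : y ≠ 0) (v : Rn n × Rn n) :
    dirDeriv (fun x y => f x y + h x y) v x y = dirDeriv f v x y + dirDeriv h v x y := by
  simp only [dirDeriv]
  rw [fderiv_fun_add (hf.differentiableAt hU hx hy) (hh.differentiableAt hU hx hy)]
  rfl

theorem dirDeriv_mul (hf : SmoothOffZero U f) (hh : SmoothOffZero U h) (hU : IsOpen U)
    (hx : x ∈ U) (hy : y ≠ 0) (v : Rn n × Rn n) :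
    dirDeriv (fun x y => f x y * h x y) v x y
      = dirDeriv f v x y * h x y + f x y * dirDeriv h v x y := by
  simp only [dirDeriv]
  rw [fderiv_fun_mul (hf.differentiableAt hU hx hy) (hh.differentiableAt hU hx hy)]
  simp only [add_apply, smul_apply, smul_eq_mul]
  ring

theorem dirDeriv_sum {ι : Type*} {s : Finset ι} {f : ι → Rn n → Rn n → ℝ}
    (hf : ∀ i ∈ s, SmoothOffZero U (f i)) (hU : IsOpen U) (hx : x ∈ U) (hy : y ≠ 0)
    (v : Rn n × Rn n) :
    dirDeriv (fun x y => ∑ i ∈ s, f i x y) v x y = ∑ i ∈ s, dirDeriv (f i) v x y := by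
  simp only [dirDeriv]
  rw [fderiv_fun_sum fun i hi => (hf i hi).differentiableAt hU hx hy]
  simp

theorem dirDeriv_fibreCoord (i : Fin n) (v : Rn n × Rn n) (x y : Rn n) :
    dirDeriv (fun _ y => y i) v x y = v.2 i := by
  have h1 : HasFDerivAt (fun q : Rn n × Rn n => q.2 i)
      ((EuclideanSpace.proj i : Rn n →L[ℝ] ℝ).comp (ContinuousLinearMap.snd ℝ (Rn n) (Rn n)))
      (x, y) :=
    ((EuclideanSpace.proj i : Rn n →L[ℝ] ℝ).comp
      (ContinuousLinearMap.snd ℝ (Rn n) (Rn n))).hasFDerivAt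
  rw [dirDeriv, h1.fderiv]
  rfl

theorem dirDeriv_ofBase {a : Rn n → ℝ} (ha : DifferentiableAt ℝ a x) (v : Rn n × Rn n)
    (y : Rn n) : dirDeriv (fun x _ => a x) v x y = fderiv ℝ a x v.1 := by
  have h1 := HasFDerivAt.comp (f := (Prod.fst : Rn n × Rn n → Rn n)) (x, y) ha.hasFDerivAt
    hasFDerivAt_fst
  have h2 := h1.fderiv
  rw [dirDeriv]
  change fderiv ℝ (a ∘ Prod.fst) (x, y) v = _
  rw [h2]
  rfl

/-- Symmetry of the second derivative on the product space. Since ∂_i and ∂̇_i are both directional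
derivatives there, this one statement gives the mixed and the purely vertical cases. -/
theorem dirDeriv_comm (hf : SmoothOffZero U f) (hU : IsOpen U) (hx : x ∈ U) (hy : y ≠ 0)
    (v w : Rn n × Rn n) :
    dirDeriv (dirDeriv f v) w x y = dirDeriv (dirDeriv f w) v x y := by
  have hs : IsSymmSndFDerivAt ℝ (fun q : Rn n × Rn n => f q.1 q.2) (x, y) :=
    (hf.contDiffAt hU hx hy).isSymmSndFDerivAt
      (by simpa using WithTop.coe_le_coe.2 (le_top : (2 : ℕ∞) ≤ ⊤))
  have hd : DifferentiableAt ℝ (fderiv ℝ (fun q : Rn n × Rn n => f q.1 q.2)) (x, y) :=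
    ((hf.contDiffAt hU hx hy).fderiv_right (m := 1)
      (WithTop.coe_le_coe.2 (le_top : (1 + 1 : ℕ∞) ≤ ⊤))).differentiableAt (by simp)
  have key : ∀ v w : Rn n × Rn n, dirDeriv (dirDeriv f v) w x y
      = fderiv ℝ (fderiv ℝ (fun q : Rn n × Rn n => f q.1 q.2)) (x, y) w v := by
    intro v w
    change fderiv ℝ (fun q => fderiv ℝ (fun q : Rn n × Rn n => f q.1 q.2) q v) (x, y) w = _
    rw [fderiv_clm_apply hd (differentiableAt_const _)]
    simp
  rw [key, key]
  exact hs.eq w v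

theorem dy_dy_comm (hf : SmoothOffZero U f) (hU : IsOpen U) (hx : x ∈ U) (hy : y ≠ 0)
    (i j : Fin n) : dy (dy f i) j x y = dy (dy f j) i x y := by
  have key : ∀ i j : Fin n, dy (dy f i) j x y
      = dirDeriv (dirDeriv f (0, EuclideanSpace.single i 1)) (0, EuclideanSpace.single j 1) x y :=
    fun i j => (dy_eq_dirDeriv (hf.dy hU i) hU hx hy j).trans
      (dirDeriv_congr hU hx hy (fun _ hx _ hy => dy_eq_dirDeriv hf hU hx hy i) _)
  rw [key, key, dirDeriv_comm hf hU hx hy]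

theorem dy_dx_comm (hf : SmoothOffZero U f) (hU : IsOpen U) (hx : x ∈ U) (hy : y ≠ 0)
    (i j : Fin n) : dy (dx f i) j x y = dx (dy f j) i x y := by
  rw [dy_eq_dirDeriv (hf.dx hU i) hU hx hy j, dx_eq_dirDeriv (hf.dy hU j) hU hx hy i,
    dirDeriv_congr hU hx hy (fun _ hx _ hy => dx_eq_dirDeriv hf hU hx hy i),
    dirDeriv_congr (f := dy f j) hU hx hy (fun _ hx _ hy => dy_eq_dirDeriv hf hU hx hy j),
    dirDeriv_comm hf hU hx hy]

theorem SmoothOffZero.det {A : Rn n → Rn n → Matrix (Fin n) (Fin n) ℝ}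
    (hA : ∀ i j, SmoothOffZero U (fun x y => A x y i j)) :
    SmoothOffZero U (fun x y => (A x y).det) := by
  simp only [Matrix.det_apply']
  exact .sum fun p _ => (SmoothOffZero.const _).mul (.prod fun i _ => hA _ _)

/-- Cramer's rule: an entry of the inverse is a quotient of determinants of matrices with smooth
entries. -/
theorem SmoothOffZero.matrixInv {A : Rn n → Rn n → Matrix (Fin n) (Fin n) ℝ}
    (hA : ∀ i j, SmoothOffZero U (fun x y => A x y i j))
    (h0 : ∀ x ∈ U, ∀ y, y ≠ 0 → (A x y).det ≠ 0) (i j : Fin n) :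
    SmoothOffZero U (fun x y => (A x y)⁻¹ i j) := by
  simp only [Matrix.inv_def, Ring.inverse_eq_inv', Matrix.smul_apply, smul_eq_mul,
    Matrix.adjugate_apply]
  refine ((SmoothOffZero.det hA).inv h0).mul (SmoothOffZero.det fun k l => ?_)
  -- The adjugate replaces row j by a constant unit vector and leaves the other rows as in A.
  by_cases hk : k = j
  · subst hk
    simpa using SmoothOffZero.const _
  · simpa [Matrix.updateRow_ne hk] using hA k l

/-- The vector `δ_k = ∂_k - N^r_k ∂̇_r` of the horizontal distribution. -/
noncomputable def horizontal (L : Rn n → Rn n → ℝ) (k : Fin n) (x y : Rn n) : Rn n × Rn n :=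
  (EuclideanSpace.single k 1, -∑ r, N L r k x y • EuclideanSpace.single r 1)

theorem delta_eq_dirDeriv (L : Rn n → Rn n → ℝ) (hf : SmoothOffZero U f) (hU : IsOpen U)
    (hx : x ∈ U) (hy : y ≠ 0) (k : Fin n) :
    delta L f k x y = dirDeriv f (horizontal L k x y) x y := by
  have hsplit : horizontal L k x y = (EuclideanSpace.single k 1, 0)
      - ∑ r, N L r k x y • ((0, EuclideanSpace.single r 1) : Rn n × Rn n) := by
    ext1 <;> simp [horizontal, Prod.fst_sum, Prod.snd_sum]
  rw [delta, dx_eq_dirDeriv hf hU hx hy, hsplit]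
  simp only [dy_eq_dirDeriv hf hU hx hy, dirDeriv, map_sub, map_sum, map_smul, smul_eq_mul]

/-- The derivative of the fibre coordinate y^i along δ_k; it supplies the N-terms when contractions
with y are differentiated horizontally. -/
theorem horizontal_snd_apply (L : Rn n → Rn n → ℝ) (i k : Fin n) (x y : Rn n) :
    (horizontal L k x y).2 i = -N L i k x y := by
  simp [horizontal, Finset.sum_apply, Pi.single_apply]

end Calculus

/-! ### Homogeneity identities for L, its fibre derivatives and the fundamental tensor. -/

section LocalFinsler

variable {n : ℕ} {U : Set (Rn n)} {L f : Rn n → Rn n → ℝ} {x y : Rn n}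

/-- The coordinate expression of a Finsler metric function over an open set `U`, with definiteness
of the fundamental tensor weakened to nondegeneracy. -/
structure IsLocalFinsler (U : Set (Rn n)) (L : Rn n → Rn n → ℝ) : Prop where
  isOpen : IsOpen U
  smooth : SmoothOffZero U L
  pos : ∀ x ∈ U, ∀ y, y ≠ 0 → 0 < L x y
  homogeneous : ∀ x y (t : ℝ), 0 < t → L x (t • y) = t * L x y
  det_ne_zero : ∀ x ∈ U, ∀ y, y ≠ 0 → (gMatrix L x y).det ≠ 0

theorem SmoothOffZero.L1 (hL : SmoothOffZero U L) (hU : IsOpen U) (i : Fin n) :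
    SmoothOffZero U (L1 L i) := hL.dy hU i

theorem SmoothOffZero.L2 (hL : SmoothOffZero U L) (hU : IsOpen U) (i j : Fin n) :
    SmoothOffZero U (L2 L i j) := (hL.L1 hU i).dy hU j

theorem fibre_eq_sum (y : Rn n) : y = ∑ i, y i • EuclideanSpace.single i (1 : ℝ) := by
  ext j
  simp [Finset.sum_apply, Pi.single_apply]

namespace IsLocalFinsler

variable (h : IsLocalFinsler U L)
include h

/-- Differentiate t ↦ L(x, ty) at t = 1 by the chain rule and by homogeneity. -/
theorem euler (hx : x ∈ U) (hy : y ≠ 0) : ∑ i, L1 L i x y * y i = L x y := by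
  have hd : HasFDerivAt (fun y' => L x y') (fderiv ℝ (fun y' => L x y') y) y := by
    have := (h.smooth.differentiableAt h.isOpen hx hy).comp y
      ((differentiableAt_const x).prodMk differentiableAt_id)
    exact DifferentiableAt.hasFDerivAt this
  have h1 : HasDerivAt (fun t : ℝ => t • y) y 1 := by
    simpa using (hasDerivAt_id (1 : ℝ)).smul_const y
  have h2 : HasDerivAt (fun t : ℝ => L x (t • y)) (fderiv ℝ (fun y' => L x y') y y) 1 :=
    HasFDerivAt.comp_hasDerivAt (f := fun t : ℝ => t • y) 1 (by simpa using hd) h1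
  have h3 : HasDerivAt (fun t : ℝ => L x (t • y)) (L x y) 1 := by
    have h4 : HasDerivAt (fun t : ℝ => t * L x y) (L x y) 1 := by
      simpa using (hasDerivAt_id (1 : ℝ)).mul_const (L x y)
    -- Homogeneity is available only for t > 0, which suffices near t = 1.
    refine h4.congr_of_eventuallyEq ?_
    filter_upwards [lt_mem_nhds (zero_lt_one' ℝ)] with t ht using h.homogeneous x y t ht
  rw [← h2.unique h3]
  conv_rhs => rw [fibre_eq_sum y, map_sum]
  refine Finset.sum_congr rfl fun i _ => ?_
  rw [map_smul, smul_eq_mul, mul_comm, ← fibre_eq_sum y]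
  rfl

/-- Keeping the direction v arbitrary lets one identity serve for ∂̇_k, ∂_k and δ_k; the second sum
comes from differentiating y^i. -/
theorem dirDeriv_euler (hx : x ∈ U) (hy : y ≠ 0) (v : Rn n × Rn n) :
    ∑ i, dirDeriv (L1 L i) v x y * y i + ∑ i, L1 L i x y * v.2 i = dirDeriv L v x y := by
  have hs := fun i => h.smooth.L1 h.isOpen i
  rw [← dirDeriv_congr (f := fun x y => ∑ i, L1 L i x y * y i) h.isOpen hx hy
      (fun x hx y hy => h.euler hx hy) v,
    dirDeriv_sum (fun i _ => (hs i).mul (.fibreCoord i)) h.isOpen hx hy,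
    ← Finset.sum_add_distrib]
  refine Finset.sum_congr rfl fun i _ => ?_
  rw [dirDeriv_mul (hs i) (.fibreCoord i) h.isOpen hx hy, dirDeriv_fibreCoord]

theorem dy_eq (hf : SmoothOffZero U f) (hx : x ∈ U) (hy : y ≠ 0) (i : Fin n) :
    dirDeriv f (0, EuclideanSpace.single i 1) x y = dy f i x y :=
  (dy_eq_dirDeriv hf h.isOpen hx hy i).symm

theorem dx_eq (hf : SmoothOffZero U f) (hx : x ∈ U) (hy : y ≠ 0) (i : Fin n) :
    dirDeriv f (EuclideanSpace.single i 1, 0) x y = dx f i x y :=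
  (dx_eq_dirDeriv hf h.isOpen hx hy i).symm

theorem L2_symm (hx : x ∈ U) (hy : y ≠ 0) (i j : Fin n) : L2 L i j x y = L2 L j i x y :=
  dy_dy_comm h.smooth h.isOpen hx hy i j

theorem L3_swap_right (hx : x ∈ U) (hy : y ≠ 0) (i j k : Fin n) :
    L3 L i j k x y = L3 L i k j x y :=
  dy_dy_comm (h.smooth.L1 h.isOpen i) h.isOpen hx hy j k

theorem L2_contract_left (hx : x ∈ U) (hy : y ≠ 0) (j : Fin n) :
    ∑ i, L2 L i j x y * y i = 0 := by
  have := h.dirDeriv_euler hx hy (0, EuclideanSpace.single j 1)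
  simp only [h.dy_eq h.smooth hx hy, h.dy_eq (h.smooth.L1 h.isOpen _) hx hy] at this
  simpa [Pi.single_apply, L1, L2] using this

theorem L2_contract (hx : x ∈ U) (hy : y ≠ 0) (i : Fin n) : ∑ j, L2 L i j x y * y j = 0 := by
  simp only [h.L2_symm hx hy i]
  exact h.L2_contract_left hx hy i

theorem dirDeriv_L2_contract (hx : x ∈ U) (hy : y ≠ 0) (i : Fin n) (v : Rn n × Rn n) :
    ∑ j, dirDeriv (L2 L i j) v x y * y j + ∑ j, L2 L i j x y * v.2 j = 0 := by
  have hs := fun j => h.smooth.L2 h.isOpen i j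
  have h0 : dirDeriv (fun _ _ : Rn n => (0 : ℝ)) v x y = 0 := by simp [dirDeriv]
  rw [← h0, ← dirDeriv_congr (f := fun x y => ∑ j, L2 L i j x y * y j) h.isOpen hx hy
      (fun x hx y hy => h.L2_contract hx hy i) v,
    dirDeriv_sum (fun j _ => (hs j).mul (.fibreCoord j)) h.isOpen hx hy,
    ← Finset.sum_add_distrib]
  refine Finset.sum_congr rfl fun j _ => ?_
  rw [dirDeriv_mul (hs j) (.fibreCoord j) h.isOpen hx hy, dirDeriv_fibreCoord]

theorem L3_contract_mid (hx : x ∈ U) (hy : y ≠ 0) (i k : Fin n) :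
    ∑ j, L3 L i j k x y * y j = -L2 L i k x y := by
  have := h.dirDeriv_L2_contract hx hy i (0, EuclideanSpace.single k 1)
  simp only [h.dy_eq (h.smooth.L2 h.isOpen _ _) hx hy] at this
  rw [eq_neg_iff_add_eq_zero]
  simpa [Pi.single_apply, L3] using this

/-- The splitting on which everything rests: only L_i and L_ij enter g, and both transform simply
under the change. -/
theorem g_eq (hx : x ∈ U) (hy : y ≠ 0) (i j : Fin n) :
    g L i j x y = L1 L i x y * L1 L j x y + L x y * L2 L i j x y := by
  have hsq : SmoothOffZero U (fun x y => (1 / 2) * L x y ^ 2) :=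
    ((SmoothOffZero.const (1 / 2)).mul (h.smooth.mul h.smooth)).congr
      fun x _ y _ => by ring
  have h1 : ∀ x ∈ U, ∀ y, y ≠ 0 →
      dy (fun x y => (1 / 2) * L x y ^ 2) j x y = L x y * L1 L j x y := by
    intro x hx y hy
    rw [← h.dy_eq hsq hx hy, dirDeriv_congr (h := fun x y => (1 / 2 * L x y) * L x y)
      h.isOpen hx hy (fun x _ y _ => by ring),
      dirDeriv_mul ((SmoothOffZero.const _).mul h.smooth) h.smooth h.isOpen hx hy,
      dirDeriv_mul (.const _) h.smooth h.isOpen hx hy, h.dy_eq h.smooth hx hy]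
    simp [dirDeriv, L1]
    ring
  rw [g, ← h.dy_eq (hsq.dy h.isOpen j) hx hy, dirDeriv_congr h.isOpen hx hy h1,
    dirDeriv_mul h.smooth (h.smooth.L1 h.isOpen j) h.isOpen hx hy, h.dy_eq h.smooth hx hy,
    h.dy_eq (h.smooth.L1 h.isOpen j) hx hy]
  change L1 L i x y * _ + _ * L2 L j i x y = _
  rw [h.L2_symm hx hy j i]

theorem g_symm (hx : x ∈ U) (hy : y ≠ 0) (i j : Fin n) : g L i j x y = g L j i x y := by
  rw [h.g_eq hx hy, h.g_eq hx hy, h.L2_symm hx hy i j]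
  ring

theorem smooth_g (i j : Fin n) : SmoothOffZero U (g L i j) :=
  (((h.smooth.L1 h.isOpen i).mul (h.smooth.L1 h.isOpen j)).add
    (h.smooth.mul (h.smooth.L2 h.isOpen i j))).congr fun _ hx _ hy => h.g_eq hx hy i j

theorem dirDeriv_g (hx : x ∈ U) (hy : y ≠ 0) (i j : Fin n) (v : Rn n × Rn n) :
    dirDeriv (g L i j) v x y
      = dirDeriv (L1 L i) v x y * L1 L j x y + L1 L i x y * dirDeriv (L1 L j) v x y
        + (dirDeriv L v x y * L2 L i j x y + L x y * dirDeriv (L2 L i j) v x y) := by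
  have h1 := fun i => h.smooth.L1 h.isOpen i
  have h2 := h.smooth.L2 h.isOpen i j
  rw [dirDeriv_congr h.isOpen hx hy (fun x hx y hy => h.g_eq hx hy i j),
    dirDeriv_add ((h1 i).mul (h1 j)) (h.smooth.mul h2) h.isOpen hx hy,
    dirDeriv_mul (h1 i) (h1 j) h.isOpen hx hy, dirDeriv_mul h.smooth h2 h.isOpen hx hy]

theorem g_contract (hx : x ∈ U) (hy : y ≠ 0) (i : Fin n) :
    ∑ j, g L i j x y * y j = L x y * L1 L i x y := by
  have : ∑ j, g L i j x y * y j
      = L1 L i x y * (∑ j, L1 L j x y * y j) + L x y * ∑ j, L2 L i j x y * y j := by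
    simp only [Finset.mul_sum, ← Finset.sum_add_distrib, h.g_eq hx hy]
    exact Finset.sum_congr rfl fun _ _ => by ring
  rw [this, h.euler hx hy, h.L2_contract hx hy]
  ring

theorem dirDeriv_g_contract (hx : x ∈ U) (hy : y ≠ 0) (i : Fin n) (v : Rn n × Rn n) :
    ∑ j, dirDeriv (g L i j) v x y * y j + ∑ j, g L i j x y * v.2 j
      = dirDeriv L v x y * L1 L i x y + L x y * dirDeriv (L1 L i) v x y := by
  have hs := fun j => h.smooth_g i j
  rw [← dirDeriv_mul h.smooth (h.smooth.L1 h.isOpen i) h.isOpen hx hy,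
    ← dirDeriv_congr (f := fun x y => ∑ j, g L i j x y * y j) h.isOpen hx hy
      (fun x hx y hy => h.g_contract hx hy i) v,
    dirDeriv_sum (fun j _ => (hs j).mul (.fibreCoord j)) h.isOpen hx hy,
    ← Finset.sum_add_distrib]
  refine Finset.sum_congr rfl fun j _ => ?_
  rw [dirDeriv_mul (hs j) (.fibreCoord j) h.isOpen hx hy, dirDeriv_fibreCoord]

theorem dx_g_contract (hx : x ∈ U) (hy : y ≠ 0) (i k : Fin n) :
    ∑ j, dx (g L i j) k x y * y j
      = dx L k x y * L1 L i x y + L x y * dx (L1 L i) k x y := by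
  have := h.dirDeriv_g_contract hx hy i (EuclideanSpace.single k 1, 0)
  simpa [h.dx_eq h.smooth hx hy, h.dx_eq (h.smooth.L1 h.isOpen _) hx hy,
    h.dx_eq (h.smooth_g _ _) hx hy] using this

theorem dx_euler (hx : x ∈ U) (hy : y ≠ 0) (k : Fin n) :
    ∑ i, dx (L1 L i) k x y * y i = dx L k x y := by
  have := h.dirDeriv_euler hx hy (EuclideanSpace.single k 1, 0)
  simpa [h.dx_eq h.smooth hx hy, h.dx_eq (h.smooth.L1 h.isOpen _) hx hy] using this

theorem dx_L2_contract (hx : x ∈ U) (hy : y ≠ 0) (i k : Fin n) :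
    ∑ j, dx (L2 L i j) k x y * y j = 0 := by
  have := h.dirDeriv_L2_contract hx hy i (EuclideanSpace.single k 1, 0)
  simpa [h.dx_eq (h.smooth.L2 h.isOpen _ _) hx hy] using this

theorem dx_g (hx : x ∈ U) (hy : y ≠ 0) (i j k : Fin n) :
    dx (g L i j) k x y
      = dx (L1 L i) k x y * L1 L j x y + L1 L i x y * dx (L1 L j) k x y
        + (dx L k x y * L2 L i j x y + L x y * dx (L2 L i j) k x y) := by
  have := h.dirDeriv_g hx hy i j (EuclideanSpace.single k 1, 0)
  simpa only [h.dx_eq h.smooth hx hy, h.dx_eq (h.smooth.L1 h.isOpen _) hx hy,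
    h.dx_eq (h.smooth.L2 h.isOpen _ _) hx hy, h.dx_eq (h.smooth_g _ _) hx hy] using this

theorem dy_g (hx : x ∈ U) (hy : y ≠ 0) (i j k : Fin n) :
    dy (g L i j) k x y
      = L2 L i k x y * L1 L j x y + L1 L i x y * L2 L j k x y
        + (L1 L k x y * L2 L i j x y + L x y * L3 L i j k x y) := by
  have := h.dirDeriv_g hx hy i j (0, EuclideanSpace.single k 1)
  simp only [h.dy_eq h.smooth hx hy, h.dy_eq (h.smooth.L1 h.isOpen _) hx hy,
    h.dy_eq (h.smooth.L2 h.isOpen _ _) hx hy, h.dy_eq (h.smooth_g _ _) hx hy] at this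
  exact this

/-- The tensor ∂̇_k g_ij is totally symmetric, being a third fibre derivative of ½L². -/
theorem dy_g_swap_right (hx : x ∈ U) (hy : y ≠ 0) (i j k : Fin n) :
    dy (g L i j) k x y = dy (g L i k) j x y := by
  rw [h.dy_g hx hy, h.dy_g hx hy, h.L3_swap_right hx hy i j k, h.L2_symm hx hy j k]
  ring

theorem dy_g_contract (hx : x ∈ U) (hy : y ≠ 0) (i k : Fin n) :
    ∑ j, dy (g L i j) k x y * y j = 0 := by
  have := h.dirDeriv_g_contract hx hy i (0, EuclideanSpace.single k 1)
  simp only [h.dy_eq h.smooth hx hy, h.dy_eq (h.smooth.L1 h.isOpen _) hx hy,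
    h.dy_eq (h.smooth_g _ _) hx hy] at this
  change _ = L1 L k x y * _ + _ * L2 L i k x y at this
  simp only [PiLp.single_apply, mul_ite, mul_one, mul_zero, Finset.sum_ite_eq',
    Finset.mem_univ, if_true, h.g_eq hx hy] at this
  linarith

theorem dy_g_contract_right (hx : x ∈ U) (hy : y ≠ 0) (i j : Fin n) :
    ∑ k, dy (g L i j) k x y * y k = 0 := by
  simp only [h.dy_g_swap_right hx hy i j]
  exact h.dy_g_contract hx hy i j

/-! The inverse of the fundamental tensor. -/

theorem sum_g_mul_gInv (hx : x ∈ U) (hy : y ≠ 0) (w : Fin n → ℝ) (r : Fin n) :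
    ∑ s, g L r s x y * ∑ t, gInv L s t x y * w t = w r := by
  have h1 : gMatrix L x y * (gMatrix L x y)⁻¹ = 1 :=
    Matrix.mul_nonsing_inv _ (isUnit_iff_ne_zero.2 (h.det_ne_zero x hx y hy))
  have h2 : (gMatrix L x y).mulVec ((gMatrix L x y)⁻¹.mulVec w) = w := by
    rw [Matrix.mulVec_mulVec, h1, Matrix.one_mulVec]
  exact congrFun h2 r

theorem sum_gInv_mul_g (hx : x ∈ U) (hy : y ≠ 0) (w : Fin n → ℝ) (r : Fin n) :
    ∑ s, gInv L r s x y * ∑ t, g L s t x y * w t = w r := by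
  have h1 : (gMatrix L x y)⁻¹ * gMatrix L x y = 1 :=
    Matrix.nonsing_inv_mul _ (isUnit_iff_ne_zero.2 (h.det_ne_zero x hx y hy))
  have h2 : (gMatrix L x y)⁻¹.mulVec ((gMatrix L x y).mulVec w) = w := by
    rw [Matrix.mulVec_mulVec, h1, Matrix.one_mulVec]
  exact congrFun h2 r

/-- Allows vector identities to be checked with the index lowered, where no inverse matrix appears.
-/
theorem g_injective (hx : x ∈ U) (hy : y ≠ 0) {v w : Fin n → ℝ}
    (H : ∀ r, ∑ s, g L r s x y * v s = ∑ s, g L r s x y * w s) : v = w := by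
  funext r
  rw [← h.sum_gInv_mul_g hx hy v r, ← h.sum_gInv_mul_g hx hy w r]
  simp only [H]

theorem gInv_symm (hx : x ∈ U) (hy : y ≠ 0) (i j : Fin n) :
    gInv L i j x y = gInv L j i x y := by
  have h1 : (gMatrix L x y).transpose = gMatrix L x y := by
    ext i j
    exact h.g_symm hx hy j i
  have h2 := Matrix.transpose_nonsing_inv (gMatrix L x y)
  rw [h1] at h2
  exact congrFun (congrFun h2 j) i

theorem smooth_gInv (i j : Fin n) : SmoothOffZero U (gInv L i j) :=
  SmoothOffZero.matrixInv (fun i j => h.smooth_g i j) h.det_ne_zero i j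

theorem smooth_spray (i : Fin n) : SmoothOffZero U (spray L i) := by
  have hc : ∀ j k, SmoothOffZero U (christoffel L i j k) := fun j k =>
    (SmoothOffZero.const _).mul (.sum fun r _ => (h.smooth_gInv i r).mul
      ((((h.smooth_g r k).dx h.isOpen j).add ((h.smooth_g r j).dx h.isOpen k)).sub
        ((h.smooth_g j k).dx h.isOpen r)))
  exact (SmoothOffZero.const _).mul (.sum fun j _ => .sum fun k _ =>
    ((hc j k).mul (.fibreCoord j)).mul (.fibreCoord k))

end IsLocalFinsler

end LocalFinsler

/-! ### The spray, the nonlinear connection and the Cartan connection. -/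

section CartanConnection

variable {n : ℕ} {U : Set (Rn n)} {L f : Rn n → Rn n → ℝ} {x y : Rn n}

/-- The derivative `y^j ∂_j f`. -/
noncomputable def radialDx (f : Rn n → Rn n → ℝ) (x y : Rn n) : ℝ := ∑ j, dx f j x y * y j

theorem SmoothOffZero.radialDx (hf : SmoothOffZero U f) (hU : IsOpen U) :
    SmoothOffZero U (radialDx f) :=
  .sum fun j _ => (hf.dx hU j).mul (.fibreCoord j)

namespace IsLocalFinsler

variable (h : IsLocalFinsler U L)
include h

theorem dirDeriv_radialDx (hf : SmoothOffZero U f) (hx : x ∈ U) (hy : y ≠ 0) (k : Fin n) :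
    dirDeriv (radialDx f) (0, EuclideanSpace.single k 1) x y
      = radialDx (dy f k) x y + dx f k x y := by
  have hs := fun j => hf.dx h.isOpen j
  change dirDeriv (fun x y => ∑ j, dx f j x y * y j) _ x y = _
  rw [dirDeriv_sum (fun j _ => (hs j).mul (.fibreCoord j)) h.isOpen hx hy]
  simp only [dirDeriv_mul (hs _) (.fibreCoord _) h.isOpen hx hy, dirDeriv_fibreCoord,
    h.dy_eq (hs _) hx hy, Finset.sum_add_distrib, dy_dx_comm hf h.isOpen hx hy]
  simp [radialDx]

theorem radialDx_g (hx : x ∈ U) (hy : y ≠ 0) (i j : Fin n) :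
    radialDx (g L i j) x y
      = radialDx (L1 L i) x y * L1 L j x y + L1 L i x y * radialDx (L1 L j) x y
        + (radialDx L x y * L2 L i j x y + L x y * radialDx (L2 L i j) x y) := by
  simp only [radialDx, Finset.mul_sum, Finset.sum_mul, ← Finset.sum_add_distrib, h.dx_g hx hy]
  exact Finset.sum_congr rfl fun _ _ => by ring

theorem radialDx_euler (hx : x ∈ U) (hy : y ≠ 0) :
    ∑ i, radialDx (L1 L i) x y * y i = radialDx L x y := by
  simp only [radialDx, ← h.dx_euler hx hy, Finset.sum_mul]
  rw [Finset.sum_comm]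
  exact Finset.sum_congr rfl fun _ _ => Finset.sum_congr rfl fun _ _ => by ring

theorem radialDx_L2_contract (hx : x ∈ U) (hy : y ≠ 0) (i : Fin n) :
    ∑ j, radialDx (L2 L i j) x y * y j = 0 := by
  have : ∑ j, radialDx (L2 L i j) x y * y j
      = ∑ k, (∑ j, dx (L2 L i j) k x y * y j) * y k := by
    simp only [radialDx, Finset.sum_mul]
    rw [Finset.sum_comm]
    exact Finset.sum_congr rfl fun _ _ => Finset.sum_congr rfl fun _ _ => by ring
  rw [this]
  simp [h.dx_L2_contract hx hy]

/-- The spray coefficients with lowered index. -/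
theorem g_mul_spray (hx : x ∈ U) (hy : y ≠ 0) (r : Fin n) :
    ∑ s, g L r s x y * spray L s x y
      = (1 / 2) * (radialDx L x y * L1 L r x y + L x y * radialDx (L1 L r) x y
          - L x y * dx L r x y) := by
  have h1 : ∀ s, spray L s x y = ∑ t, gInv L s t x y * ((1 / 4) * ∑ j, ∑ k,
      (dx (g L t k) j x y + dx (g L t j) k x y - dx (g L j k) t x y) * y j * y k) := by
    intro s
    simp only [spray, christoffel, Finset.mul_sum, Finset.sum_mul]
    conv_rhs => rw [Finset.sum_comm]
    refine Finset.sum_congr rfl fun j _ => ?_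
    conv_rhs => rw [Finset.sum_comm]
    exact Finset.sum_congr rfl fun k _ => Finset.sum_congr rfl fun t _ => by ring
  simp only [h1]
  rw [h.sum_g_mul_gInv hx hy]
  have h2 : ∑ j, ∑ k, (dx (g L r k) j x y + dx (g L r j) k x y - dx (g L j k) r x y) * y j * y k
      = ∑ j, (∑ k, dx (g L r k) j x y * y k) * y j + ∑ k, (∑ j, dx (g L r j) k x y * y j) * y k
        - ∑ j, (∑ k, dx (g L j k) r x y * y k) * y j := by
    simp only [Finset.sum_mul]
    conv_rhs => lhs; rhs; rw [Finset.sum_comm]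
    simp only [← Finset.sum_add_distrib, ← Finset.sum_sub_distrib]
    exact Finset.sum_congr rfl fun _ _ => Finset.sum_congr rfl fun _ _ => by ring
  have h3 : ∑ j, (∑ k, dx (g L r k) j x y * y k) * y j
      = radialDx L x y * L1 L r x y + L x y * radialDx (L1 L r) x y := by
    simp only [h.dx_g_contract hx hy, radialDx, Finset.sum_mul, Finset.mul_sum,
      ← Finset.sum_add_distrib]
    exact Finset.sum_congr rfl fun _ _ => by ring
  have h4 : ∑ j, (∑ k, dx (g L j k) r x y * y k) * y j
      = dx L r x y * (∑ j, L1 L j x y * y j) + L x y * ∑ j, dx (L1 L j) r x y * y j := by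
    simp only [h.dx_g_contract hx hy, Finset.mul_sum, ← Finset.sum_add_distrib]
    exact Finset.sum_congr rfl fun _ _ => by ring
  -- The first two sums in `h2` differ only in the names of bound indices, so `h3` evaluates both.
  rw [h2, h3, h4, h.euler hx hy, h.dx_euler hx hy]
  ring

/-- The nonlinear connection with lowered index. -/
theorem g_mul_N (hx : x ∈ U) (hy : y ≠ 0) (r k : Fin n) :
    ∑ s, dy (g L r s) k x y * spray L s x y + ∑ s, g L r s x y * N L s k x y
      = (1 / 2) * ((dx L k x y + radialDx (L1 L k) x y) * L1 L r x y
          + radialDx L x y * L2 L r k x y + L1 L k x y * radialDx (L1 L r) x y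
          + L x y * (dx (L1 L r) k x y + radialDx (L2 L r k) x y)
          - (L1 L k x y * dx L r x y + L x y * dx (L1 L k) r x y)) := by
  have hU := h.isOpen
  have s1 := h.smooth.L1 hU r
  have sP := h.smooth.radialDx hU
  have sP1 := s1.radialDx hU
  have sx := h.smooth.dx hU r
  have sS := fun s => h.smooth_spray s
  have sg := fun s => h.smooth_g r s
  -- This is the lowered spray identity, to be differentiated along ∂̇_k; the factor -1 lets the sum
  -- and product rules suffice.
  have e : ∀ x ∈ U, ∀ y, y ≠ 0 → ∑ s, g L r s x y * spray L s x y
      = (1 / 2) * ((radialDx L x y * L1 L r x y + L x y * radialDx (L1 L r) x y)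
          + (-1) * (L x y * dx L r x y)) := fun x hx y hy => by
    rw [h.g_mul_spray hx hy r]
    ring
  have key := dirDeriv_congr hU hx hy e (0, EuclideanSpace.single k 1)
  have h0 : ∀ a : ℝ, dirDeriv (fun _ _ : Rn n => a) (0, EuclideanSpace.single k 1) x y = 0 :=
    fun a => by simp [dirDeriv]
  rw [dirDeriv_sum (fun s _ => (sg s).mul (sS s)) hU hx hy,
    dirDeriv_mul (.const _) (((sP.mul s1).add (h.smooth.mul sP1)).add
      ((SmoothOffZero.const _).mul (h.smooth.mul sx))) hU hx hy,
    dirDeriv_add ((sP.mul s1).add (h.smooth.mul sP1))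
      ((SmoothOffZero.const _).mul (h.smooth.mul sx)) hU hx hy,
    dirDeriv_add (sP.mul s1) (h.smooth.mul sP1) hU hx hy,
    dirDeriv_mul sP s1 hU hx hy, dirDeriv_mul h.smooth sP1 hU hx hy,
    dirDeriv_mul (.const _) (h.smooth.mul sx) hU hx hy,
    dirDeriv_mul h.smooth sx hU hx hy, h0, h0, h.dirDeriv_radialDx h.smooth hx hy,
    h.dirDeriv_radialDx s1 hx hy, h.dy_eq h.smooth hx hy, h.dy_eq s1 hx hy, h.dy_eq sx hx hy,
    dy_dx_comm h.smooth hU hx hy] at key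
  simp only [dirDeriv_mul (sg _) (sS _) hU hx hy, h.dy_eq (sg _) hx hy, h.dy_eq (sS _) hx hy,
    Finset.sum_add_distrib] at key
  refine key.trans ?_
  change 0 * _ + 1 / 2 * ((radialDx (L1 L k) x y + dx L k x y) * _ + _ * L2 L r k x y
    + (L1 L k x y * _ + _ * (radialDx (L2 L r k) x y + _))
    + (0 * _ + -1 * (L1 L k x y * _ + _ * dx (L1 L k) r x y))) = _
  ring

/-- Contract `g_mul_N` with y^k: the term with ∂̇_k g drops out, and Euler's relations reduce the
rest to twice the lowered spray. -/
theorem N_contract (hx : x ∈ U) (hy : y ≠ 0) (s : Fin n) :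
    ∑ k, N L s k x y * y k = 2 * spray L s x y := by
  refine congrFun (h.g_injective hx hy (v := fun s => ∑ k, N L s k x y * y k)
    (w := fun s => 2 * spray L s x y) fun r => ?_) s
  have h1 : ∑ k, (∑ s, dy (g L r s) k x y * spray L s x y + ∑ s, g L r s x y * N L s k x y) * y k
      = ∑ s, (∑ k, dy (g L r s) k x y * y k) * spray L s x y
        + ∑ s, g L r s x y * ∑ k, N L s k x y * y k := by
    simp only [add_mul, Finset.sum_mul, Finset.sum_add_distrib, Finset.mul_sum]
    congr 1 <;>
    · rw [Finset.sum_comm]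
      exact Finset.sum_congr rfl fun _ _ => Finset.sum_congr rfl fun _ _ => by ring
  have h2 : ∑ s, g L r s x y * (2 * spray L s x y) = 2 * ∑ s, g L r s x y * spray L s x y := by
    rw [Finset.mul_sum]
    exact Finset.sum_congr rfl fun _ _ => by ring
  simp only [h.dy_g_contract_right hx hy, zero_mul, Finset.sum_const_zero, zero_add,
    h.g_mul_N hx hy] at h1
  rw [← h1, h2, h.g_mul_spray hx hy]
  have h3 : ∑ k, (1 / 2) * ((dx L k x y + radialDx (L1 L k) x y) * L1 L r x y
          + radialDx L x y * L2 L r k x y + L1 L k x y * radialDx (L1 L r) x y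
          + L x y * (dx (L1 L r) k x y + radialDx (L2 L r k) x y)
          - (L1 L k x y * dx L r x y + L x y * dx (L1 L k) r x y)) * y k
      = (1 / 2) * ((radialDx L x y + ∑ k, radialDx (L1 L k) x y * y k) * L1 L r x y
          + radialDx L x y * (∑ k, L2 L r k x y * y k)
          + (∑ k, L1 L k x y * y k) * radialDx (L1 L r) x y
          + L x y * (radialDx (L1 L r) x y + ∑ k, radialDx (L2 L r k) x y * y k)
          - ((∑ k, L1 L k x y * y k) * dx L r x y + L x y * ∑ k, dx (L1 L k) r x y * y k)) := by
    rw [show radialDx L x y + ∑ k, radialDx (L1 L k) x y * y k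
      = ∑ k, (dx L k x y + radialDx (L1 L k) x y) * y k by
        simp only [add_mul, Finset.sum_add_distrib]; rfl,
      show radialDx (L1 L r) x y + ∑ k, radialDx (L2 L r k) x y * y k
      = ∑ k, (dx (L1 L r) k x y + radialDx (L2 L r k) x y) * y k by
        simp only [add_mul, Finset.sum_add_distrib]; rfl]
    simp only [Finset.sum_mul, Finset.mul_sum, ← Finset.sum_add_distrib,
      ← Finset.sum_sub_distrib]
    exact Finset.sum_congr rfl fun _ _ => by ring
  rw [h3, h.radialDx_euler hx hy, h.L2_contract hx hy, h.euler hx hy,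
    h.radialDx_L2_contract hx hy, h.dx_euler hx hy]
  ring

theorem delta_congr {f₁ f₂ : Rn n → Rn n → ℝ} (h₁ : SmoothOffZero U f₁)
    (H : ∀ x ∈ U, ∀ y, y ≠ 0 → f₁ x y = f₂ x y) (hx : x ∈ U) (hy : y ≠ 0) (k : Fin n) :
    delta L f₁ k x y = delta L f₂ k x y := by
  have h₂ : SmoothOffZero U f₂ := h₁.congr fun x hx y hy => (H x hx y hy).symm
  rw [delta_eq_dirDeriv L h₁ h.isOpen hx hy, delta_eq_dirDeriv L h₂ h.isOpen hx hy,
    dirDeriv_congr h.isOpen hx hy H]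

theorem delta_g_symm (hx : x ∈ U) (hy : y ≠ 0) (i j k : Fin n) :
    delta L (g L i j) k x y = delta L (g L j i) k x y :=
  h.delta_congr (h.smooth_g i j) (fun _ hx _ hy => h.g_symm hx hy i j) hx hy k

theorem cartan_symm (hx : x ∈ U) (hy : y ≠ 0) (i j k : Fin n) :
    cartan L i j k x y = cartan L i k j x y := by
  simp only [cartan, h.delta_g_symm hx hy j k]
  congr 1
  exact Finset.sum_congr rfl fun _ _ => by ring

theorem g_mul_cartan (hx : x ∈ U) (hy : y ≠ 0) (r j k : Fin n) :
    ∑ s, g L r s x y * cartan L s j k x y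
      = (1 / 2) * (delta L (g L r k) j x y + delta L (g L r j) k x y
          - delta L (g L j k) r x y) := by
  have h1 : ∀ s, cartan L s j k x y = ∑ t, gInv L s t x y * ((1 / 2) *
      (delta L (g L t k) j x y + delta L (g L t j) k x y - delta L (g L j k) t x y)) := by
    intro s
    rw [cartan, Finset.mul_sum]
    exact Finset.sum_congr rfl fun _ _ => by ring
  simp only [h1]
  rw [h.sum_g_mul_gInv hx hy]

/-- The Cartan connection is metrical. -/
theorem delta_g (hx : x ∈ U) (hy : y ≠ 0) (i j k : Fin n) :
    delta L (g L i j) k x y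
      = ∑ s, g L j s x y * cartan L s i k x y + ∑ s, g L i s x y * cartan L s j k x y := by
  rw [h.g_mul_cartan hx hy, h.g_mul_cartan hx hy, h.delta_g_symm hx hy j i,
    h.delta_g_symm hx hy j k, h.delta_g_symm hx hy i k]
  ring

/-- The Cartan connection is deflection-free: `Γ^s_jk y^j = N^s_k`. -/
theorem cartan_contract (hx : x ∈ U) (hy : y ≠ 0) (s k : Fin n) :
    ∑ j, cartan L s j k x y * y j = N L s k x y := by
  refine congrFun (h.g_injective hx hy (v := fun s => ∑ j, cartan L s j k x y * y j)
    (w := fun s => N L s k x y) fun r => ?_) s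
  have h1 : ∑ s, g L r s x y * ∑ j, cartan L s j k x y * y j
      = ∑ j, (∑ s, g L r s x y * cartan L s j k x y) * y j := by
    simp only [Finset.mul_sum, Finset.sum_mul]
    rw [Finset.sum_comm]
    exact Finset.sum_congr rfl fun _ _ => Finset.sum_congr rfl fun _ _ => by ring
  have h2 : ∀ a l, ∑ j, delta L (g L a j) l x y * y j
      = dx L l x y * L1 L a x y + L x y * dx (L1 L a) l x y := by
    intro a l
    have : ∑ j, delta L (g L a j) l x y * y j = ∑ j, dx (g L a j) l x y * y j
        - ∑ t, N L t l x y * ∑ j, dy (g L a j) t x y * y j := by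
      simp only [delta, sub_mul, Finset.sum_sub_distrib, Finset.sum_mul, Finset.mul_sum]
      rw [Finset.sum_comm]
      congr 1
      exact Finset.sum_congr rfl fun _ _ => Finset.sum_congr rfl fun _ _ => by ring
    rw [this, h.dx_g_contract hx hy]
    simp [h.dy_g_contract hx hy]
  -- Contraction in the derivative index turns N^t_j y^j into 2G^t, and total symmetry of ∂̇_t g_rk
  -- produces the spray term of `g_mul_N`.
  have h3 : ∑ j, delta L (g L r k) j x y * y j = radialDx (g L r k) x y
      - 2 * ∑ t, dy (g L r t) k x y * spray L t x y := by
    have : ∑ j, delta L (g L r k) j x y * y j = radialDx (g L r k) x y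
        - ∑ t, (∑ j, N L t j x y * y j) * dy (g L r k) t x y := by
      simp only [delta, radialDx, sub_mul, Finset.sum_sub_distrib, Finset.sum_mul]
      rw [Finset.sum_comm]
      congr 1
      exact Finset.sum_congr rfl fun _ _ => Finset.sum_congr rfl fun _ _ => by ring
    rw [this, Finset.mul_sum]
    congr 1
    refine Finset.sum_congr rfl fun t _ => ?_
    rw [h.N_contract hx hy, h.dy_g_swap_right hx hy r k t]
    ring
  have h4 : ∑ j, (∑ s, g L r s x y * cartan L s j k x y) * y j
      = (1 / 2) * (∑ j, delta L (g L r k) j x y * y j + ∑ j, delta L (g L r j) k x y * y j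
        - ∑ j, delta L (g L k j) r x y * y j) := by
    simp only [h.g_mul_cartan hx hy, h.delta_g_symm hx hy k _, Finset.mul_sum,
      ← Finset.sum_add_distrib, ← Finset.sum_sub_distrib]
    exact Finset.sum_congr rfl fun _ _ => by ring
  rw [h1, h4, h2, h2, h3, h.radialDx_g hx hy]
  have h5 := h.g_mul_N hx hy r k
  linarith

/-! ### Horizontal parallelism of L, L_i and L_ij. -/

theorem dirDeriv_horizontal (hf : SmoothOffZero U f) (hx : x ∈ U) (hy : y ≠ 0) (k : Fin n) :
    dirDeriv f (horizontal L k x y) x y = delta L f k x y :=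
  (delta_eq_dirDeriv L hf h.isOpen hx hy k).symm

theorem g_contract_cartan (hx : x ∈ U) (hy : y ≠ 0) (i k : Fin n) :
    ∑ j, (∑ s, g L i s x y * cartan L s j k x y) * y j = ∑ s, g L i s x y * N L s k x y := by
  simp only [← h.cartan_contract hx hy, Finset.mul_sum, Finset.sum_mul]
  rw [Finset.sum_comm]
  exact Finset.sum_congr rfl fun _ _ => Finset.sum_congr rfl fun _ _ => by ring

/-- Differentiate g_ij y^j = L L_i along δ_k. By metricity and vanishing deflection, the N-terms
cancel. -/
theorem delta_L_L1 (hx : x ∈ U) (hy : y ≠ 0) (i k : Fin n) :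
    delta L L k x y * L1 L i x y + L x y * delta L (L1 L i) k x y
      = L x y * ∑ s, L1 L s x y * cartan L s i k x y := by
  have h1 := h.dirDeriv_g_contract hx hy i (horizontal L k x y)
  simp only [h.dirDeriv_horizontal h.smooth hx hy, h.dirDeriv_horizontal (h.smooth_g _ _) hx hy,
    h.dirDeriv_horizontal (h.smooth.L1 h.isOpen _) hx hy, horizontal_snd_apply, mul_neg,
    Finset.sum_neg_distrib, h.delta_g hx hy, add_mul, Finset.sum_add_distrib,
    h.g_contract_cartan hx hy] at h1
  have h2 : ∑ j, (∑ s, g L j s x y * cartan L s i k x y) * y j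
      = ∑ s, (∑ j, g L s j x y * y j) * cartan L s i k x y := by
    simp only [Finset.sum_mul]
    rw [Finset.sum_comm]
    refine Finset.sum_congr rfl fun s _ => Finset.sum_congr rfl fun j _ => ?_
    rw [h.g_symm hx hy j s]
    ring
  simp only [h.g_contract hx hy] at h2
  rw [← h1, h2, Finset.mul_sum, add_neg_cancel_right]
  exact Finset.sum_congr rfl fun _ _ => by ring

theorem delta_L (hx : x ∈ U) (hy : y ≠ 0) (k : Fin n) : delta L L k x y = 0 := by
  have h1 : ∑ i, (delta L L k x y * L1 L i x y + L x y * delta L (L1 L i) k x y) * y i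
      = ∑ i, (L x y * ∑ s, L1 L s x y * cartan L s i k x y) * y i :=
    Finset.sum_congr rfl fun i _ => by rw [h.delta_L_L1 hx hy i k]
  have h2 : ∑ i, (L x y * ∑ s, L1 L s x y * cartan L s i k x y) * y i
      = L x y * ∑ s, L1 L s x y * N L s k x y := by
    simp only [← h.cartan_contract hx hy, Finset.mul_sum, Finset.sum_mul]
    rw [Finset.sum_comm]
    exact Finset.sum_congr rfl fun _ _ => Finset.sum_congr rfl fun _ _ => by ring
  have h3 : ∑ i, (delta L L k x y * L1 L i x y + L x y * delta L (L1 L i) k x y) * y i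
      = delta L L k x y * (∑ i, L1 L i x y * y i)
        + L x y * ∑ i, delta L (L1 L i) k x y * y i := by
    simp only [Finset.mul_sum, ← Finset.sum_add_distrib]
    exact Finset.sum_congr rfl fun _ _ => by ring
  have h4 := h.dirDeriv_euler hx hy (horizontal L k x y)
  simp only [h.dirDeriv_horizontal h.smooth hx hy,
    h.dirDeriv_horizontal (h.smooth.L1 h.isOpen _) hx hy, horizontal_snd_apply, mul_neg,
    Finset.sum_neg_distrib] at h4
  rw [h2, h3, h.euler hx hy] at h1
  have hL := h.pos x hx y hy
  -- Contracting `delta_L_L1` with y and differentiating Euler's relation give two equations;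
  -- eliminating y^i δ_k L_i - L_i N^i_k leaves 2L δ_k L = 0.
  have h5 : L x y * (2 * delta L L k x y) = 0 := by linear_combination h1 - L x y * h4
  have := (mul_eq_zero.1 h5).resolve_left hL.ne'
  linarith

theorem delta_L1 (hx : x ∈ U) (hy : y ≠ 0) (i k : Fin n) :
    delta L (L1 L i) k x y = ∑ s, L1 L s x y * cartan L s i k x y := by
  have h1 := h.delta_L_L1 hx hy i k
  rw [h.delta_L hx hy, zero_mul, zero_add] at h1
  exact mul_left_cancel₀ (h.pos x hx y hy).ne' h1

/-- In g_ij = L_i L_j + L L_ij the tensors g, L and L_i are already parallel; dividing by L > 0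
leaves L_ij. -/
theorem delta_L2 (hx : x ∈ U) (hy : y ≠ 0) (i j k : Fin n) :
    delta L (L2 L i j) k x y
      = ∑ s, L2 L j s x y * cartan L s i k x y + ∑ s, L2 L i s x y * cartan L s j k x y := by
  have h1 := h.dirDeriv_g hx hy i j (horizontal L k x y)
  simp only [h.dirDeriv_horizontal h.smooth hx hy, h.dirDeriv_horizontal (h.smooth_g _ _) hx hy,
    h.dirDeriv_horizontal (h.smooth.L1 h.isOpen _) hx hy,
    h.dirDeriv_horizontal (h.smooth.L2 h.isOpen _ _) hx hy, h.delta_L hx hy, zero_mul, zero_add,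
    h.delta_g hx hy, h.delta_L1 hx hy] at h1
  have h2 : ∀ a b, ∑ s, g L a s x y * cartan L s b k x y
      = L1 L a x y * (∑ s, L1 L s x y * cartan L s b k x y)
        + L x y * ∑ s, L2 L a s x y * cartan L s b k x y := by
    intro a b
    simp only [Finset.mul_sum, ← Finset.sum_add_distrib, h.g_eq hx hy]
    exact Finset.sum_congr rfl fun _ _ => by ring
  rw [h2, h2] at h1
  refine mul_left_cancel₀ (h.pos x hx y hy).ne' ?_
  linear_combination -h1

end IsLocalFinsler

end CartanConnection

/-! ### Recovering a vector from its contractions, and fibre derivatives of L̄. -/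

section BetaConformalChange

variable {n : ℕ} {U : Set (Rn n)} {L f : Rn n → Rn n → ℝ} {x y : Rn n}
  {σ : Rn n → ℝ} {b : Fin n → Rn n → ℝ}

/-- The contraction `Dⁱ_0k` of a tensor `Dⁱ_jk`. -/
noncomputable def contractMid (D : Fin n → Fin n → Fin n → ℝ) (y : Rn n) (i k : Fin n) : ℝ :=
  ∑ j, D i j k * y j

/-- The contraction `Dⁱ_00` of a tensor `Dⁱ_jk`. -/
noncomputable def contractBoth (D : Fin n → Fin n → Fin n → ℝ) (y : Rn n) (i : Fin n) : ℝ :=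
  ∑ k, contractMid D y i k * y k

theorem sum_mul_contractMid (D : Fin n → Fin n → Fin n → ℝ) (y : Rn n) (a : Fin n → ℝ)
    (k : Fin n) : ∑ r, a r * contractMid D y r k = ∑ j, (∑ r, a r * D r j k) * y j := by
  simp only [contractMid, Finset.mul_sum, Finset.sum_mul]
  rw [Finset.sum_comm]
  exact Finset.sum_congr rfl fun _ _ => Finset.sum_congr rfl fun _ _ => by ring

theorem sum_mul_contractBoth (D : Fin n → Fin n → Fin n → ℝ) (y : Rn n) (a : Fin n → ℝ) :
    ∑ r, a r * contractBoth D y r = ∑ k, (∑ r, a r * contractMid D y r k) * y k := by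
  simp only [contractBoth, Finset.mul_sum, Finset.sum_mul]
  rw [Finset.sum_comm]
  exact Finset.sum_congr rfl fun _ _ => Finset.sum_congr rfl fun _ _ => by ring

/-- The difference of the Cartan connections of `L̄` and `L`. -/
noncomputable def diffTensor (L : Rn n → Rn n → ℝ) (σ : Rn n → ℝ) (b : Fin n → Rn n → ℝ)
    (x y : Rn n) (i j k : Fin n) : ℝ :=
  cartan (Lbar L σ b) i j k x y - cartan L i j k x y

theorem dy_ofBase {a : Rn n → ℝ} (k : Fin n) : dy (fun x _ => a x) k x y = 0 := by
  simp [dy]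

namespace IsLocalFinsler

variable (h : IsLocalFinsler U L)

include h in
/-- A vector is determined by its contractions with `L_ir` and with `L̄_r`. -/
theorem eq_of_contractions (hbar : 0 < Lbar L σ b x y) (hx : x ∈ U) (hy : y ≠ 0)
    {w K : Fin n → ℝ} {H : ℝ} (hK : ∀ i, ∑ r, L2 L i r x y * w r = K i)
    (hH : ∑ r, (Real.exp (σ x) * L1 L r x y + b r x) * w r = H) (i : Fin n) :
    w i = L x y * (∑ r, gInv L i r x y * K r)
      + L x y / Lbar L σ b x y * (H - L x y * ∑ r, bUp L b r x y * K r) * Lup L i x y := by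
  have hL := h.pos x hx y hy
  -- Given K, the splitting of g leaves only the scalar X = L_r w^r unknown: w^i = L^i X + L g^ir
  -- K_r.
  obtain ⟨X, hX⟩ : ∃ X, X = ∑ r, L1 L r x y * w r := ⟨_, rfl⟩
  have h1 : ∀ r, ∑ s, g L r s x y * w s = L1 L r x y * X + L x y * K r := by
    intro r
    simp only [hX, ← hK, Finset.mul_sum, ← Finset.sum_add_distrib, h.g_eq hx hy]
    exact Finset.sum_congr rfl fun _ _ => by ring
  have h2 : ∀ i, ∑ r, gInv L i r x y * L1 L r x y = Lup L i x y := by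
    intro i
    have := h.sum_gInv_mul_g hx hy (fun j => y j) i
    simp only [h.g_contract hx hy] at this
    rw [Lup, eq_div_iff hL.ne', ← this, Finset.sum_mul]
    exact Finset.sum_congr rfl fun _ _ => by ring
  have h3 : ∀ i, w i = Lup L i x y * X + L x y * ∑ r, gInv L i r x y * K r := by
    intro i
    rw [← h.sum_gInv_mul_g hx hy w i, ← h2 i]
    simp only [h1, Finset.mul_sum, Finset.sum_mul, ← Finset.sum_add_distrib]
    exact Finset.sum_congr rfl fun _ _ => by ring
  have h4 : ∑ i, b i x * ∑ r, gInv L i r x y * K r = ∑ r, bUp L b r x y * K r := by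
    simp only [bUp, Finset.mul_sum, Finset.sum_mul]
    rw [Finset.sum_comm]
    refine Finset.sum_congr rfl fun r _ => Finset.sum_congr rfl fun s _ => ?_
    rw [h.gInv_symm hx hy r s]
    ring
  have h5 : H = Real.exp (σ x) * X + (X / L x y * (∑ i, b i x * y i)
      + L x y * ∑ r, bUp L b r x y * K r) := by
    have e1 : ∑ r, b r x * w r = X / L x y * (∑ i, b i x * y i)
        + L x y * ∑ i, b i x * ∑ r, gInv L i r x y * K r := by
      rw [Finset.mul_sum, Finset.mul_sum, ← Finset.sum_add_distrib]
      refine Finset.sum_congr rfl fun i _ => ?_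
      rw [h3 i, Lup]
      ring
    rw [← h4, ← e1, ← hH, hX, Finset.mul_sum, ← Finset.sum_add_distrib]
    exact Finset.sum_congr rfl fun _ _ => by ring
  -- In `h5` the coefficient of X is e^σ + β/L = L̄/L, which is positive.
  have h6 : L x y / Lbar L σ b x y * (H - L x y * ∑ r, bUp L b r x y * K r) = X := by
    have e2 : H - L x y * ∑ r, bUp L b r x y * K r = X / L x y * Lbar L σ b x y := by
      rw [h5, Lbar]
      field_simp
      ring
    rw [e2]
    field_simp
  rw [h6, h3 i]
  ring

variable (hσ : ContDiffOn ℝ ∞ σ U) (hb : ∀ i, ContDiffOn ℝ ∞ (b i) U)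

include h hσ in
theorem dirDeriv_exp_mul (hf : SmoothOffZero U f) (hx : x ∈ U) (hy : y ≠ 0)
    (v : Rn n × Rn n) :
    dirDeriv (fun x y => Real.exp (σ x) * f x y) v x y
      = Real.exp (σ x) * fderiv ℝ σ x v.1 * f x y + Real.exp (σ x) * dirDeriv f v x y := by
  have hd := (hσ.contDiffAt (h.isOpen.mem_nhds hx)).differentiableAt (by simp)
  rw [dirDeriv_mul (.ofBase hσ.exp) hf h.isOpen hx hy, dirDeriv_ofBase hd.exp,
    fderiv_exp hd]
  simp

include h hσ in
theorem delta_exp_mul (hf : SmoothOffZero U f) (hx : x ∈ U) (hy : y ≠ 0) (k : Fin n) :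
    delta L (fun x y => Real.exp (σ x) * f x y) k x y
      = Real.exp (σ x) * σd σ k x * f x y + Real.exp (σ x) * delta L f k x y := by
  rw [delta_eq_dirDeriv L ((SmoothOffZero.ofBase hσ.exp).mul hf) h.isOpen hx hy,
    h.dirDeriv_exp_mul hσ hf hx hy, h.dirDeriv_horizontal hf hx hy]
  rfl

include h hσ in
theorem dy_exp_mul (hf : SmoothOffZero U f) (hx : x ∈ U) (hy : y ≠ 0) (k : Fin n) :
    dy (fun x y => Real.exp (σ x) * f x y) k x y = Real.exp (σ x) * dy f k x y := by
  rw [dy_eq_dirDeriv ((SmoothOffZero.ofBase hσ.exp).mul hf) h.isOpen hx hy,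
    h.dirDeriv_exp_mul hσ hf hx hy, h.dy_eq hf hx hy]
  simp

include h hσ hb in
theorem L1_Lbar (hx : x ∈ U) (hy : y ≠ 0) (i : Fin n) :
    L1 (Lbar L σ b) i x y = Real.exp (σ x) * L1 L i x y + b i x := by
  have s1 : SmoothOffZero U fun x y => Real.exp (σ x) * L x y :=
    (SmoothOffZero.ofBase hσ.exp).mul h.smooth
  have sb := fun i => (SmoothOffZero.ofBase (hb i)).mul (.fibreCoord (U := U) i)
  have s2 : SmoothOffZero U (Lbar L σ b) := s1.add (.sum fun i _ => sb i)
  rw [L1, dy_eq_dirDeriv s2 h.isOpen hx hy]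
  change dirDeriv (fun x y => Real.exp (σ x) * L x y + ∑ i, b i x * y i) _ x y = _
  rw [dirDeriv_add s1 (.sum fun i _ => sb i) h.isOpen hx hy,
    dirDeriv_sum (fun i _ => sb i) h.isOpen hx hy, h.dirDeriv_exp_mul hσ h.smooth hx hy,
    h.dy_eq h.smooth hx hy]
  simp only [dirDeriv_mul (.ofBase (hb _)) (.fibreCoord _) h.isOpen hx hy, dirDeriv_fibreCoord,
    h.dy_eq (.ofBase (hb _)) hx hy, dy_ofBase]
  simp [L1]

include h hσ hb in
theorem L2_Lbar (hx : x ∈ U) (hy : y ≠ 0) (i j : Fin n) :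
    L2 (Lbar L σ b) i j x y = Real.exp (σ x) * L2 L i j x y := by
  have s1 := h.smooth.L1 h.isOpen i
  have s2 : SmoothOffZero U fun x y => Real.exp (σ x) * L1 L i x y :=
    (SmoothOffZero.ofBase hσ.exp).mul s1
  have s3 : SmoothOffZero U (L1 (Lbar L σ b) i) :=
    (s2.add (.ofBase (hb i))).congr fun x hx y hy => h.L1_Lbar hσ hb hx hy i
  rw [L2, dy_eq_dirDeriv s3 h.isOpen hx hy,
    dirDeriv_congr h.isOpen hx hy (fun x hx y hy => h.L1_Lbar hσ hb hx hy i),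
    dirDeriv_add s2 (.ofBase (hb i)) h.isOpen hx hy, h.dy_eq s2 hx hy,
    h.dy_eq (.ofBase (hb i)) hx hy, dy_ofBase, h.dy_exp_mul hσ s1 hx hy, add_zero]
  rfl

/-! ### The linear equations for the difference tensor and their solution. -/

section Difference

variable (h' : IsLocalFinsler U (Lbar L σ b))

local notation "Dxy" => diffTensor L σ b x y

include h h' in
theorem diffTensor_symm (hx : x ∈ U) (hy : y ≠ 0) (i j k : Fin n) :
    Dxy i j k = Dxy i k j := by
  rw [diffTensor, diffTensor, h.cartan_symm hx hy, h'.cartan_symm hx hy]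

include h h' in
-- Both connections are deflection-free, so D^r_0k is the difference of the nonlinear connections.
-- This is what enters δ̄_k - δ_k.
theorem contractMid_diffTensor (hx : x ∈ U) (hy : y ≠ 0) (r k : Fin n) :
    contractMid Dxy y r k = N (Lbar L σ b) r k x y - N L r k x y := by
  simp only [contractMid, diffTensor, sub_mul, Finset.sum_sub_distrib, h.cartan_contract hx hy,
    h'.cartan_contract hx hy]

include h h' in
theorem delta_Lbar (hx : x ∈ U) (hy : y ≠ 0) (k : Fin n) :
    delta (Lbar L σ b) f k x y
      = delta L f k x y - ∑ r, contractMid Dxy y r k * dy f r x y := by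
  simp only [h.contractMid_diffTensor h' hx hy, delta, sub_mul, Finset.sum_sub_distrib]
  ring

include h h' hσ hb in
-- Parallelism of L̄_i for the new connection, compared with that of L_i for the old one; b_i is not
-- parallel and leaves b_i|k.
theorem L1_Lbar_mul_diffTensor (hx : x ∈ U) (hy : y ≠ 0) (i k : Fin n) :
    ∑ r, (Real.exp (σ x) * L1 L r x y + b r x) * Dxy r i k
      = Real.exp (σ x) * σd σ k x * L1 L i x y + bCov L b i k x y
        - Real.exp (σ x) * ∑ r, L2 L i r x y * contractMid Dxy y r k := by
  have s1 := h.smooth.L1 h.isOpen i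
  have s2 : SmoothOffZero U fun x y => Real.exp (σ x) * L1 L i x y :=
    (SmoothOffZero.ofBase hσ.exp).mul s1
  have sb : SmoothOffZero U fun x _ => b i x := .ofBase (hb i)
  have e1 := h'.delta_L1 hx hy i k
  rw [h.delta_Lbar h' hx hy,
    h.delta_congr (h'.smooth.L1 h.isOpen i) (fun x hx y hy => h.L1_Lbar hσ hb hx hy i) hx hy,
    delta_eq_dirDeriv L (s2.add sb) h.isOpen hx hy, dirDeriv_add s2 sb h.isOpen hx hy,
    h.dirDeriv_horizontal s2 hx hy, h.dirDeriv_horizontal sb hx hy,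
    h.delta_exp_mul hσ s1 hx hy, h.delta_L1 hx hy] at e1
  change _ - ∑ r, _ * L2 (Lbar L σ b) i r x y = _ at e1
  simp only [h.L1_Lbar hσ hb hx hy, h.L2_Lbar hσ hb hx hy] at e1
  have e2 : ∑ r, contractMid Dxy y r k * (Real.exp (σ x) * L2 L i r x y)
      = Real.exp (σ x) * ∑ r, L2 L i r x y * contractMid Dxy y r k := by
    rw [Finset.mul_sum]
    exact Finset.sum_congr rfl fun _ _ => by ring
  have e3 : ∑ r, (Real.exp (σ x) * L1 L r x y + b r x) * Dxy r i k
      = ∑ r, (Real.exp (σ x) * L1 L r x y + b r x) * cartan (Lbar L σ b) r i k x y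
        - (Real.exp (σ x) * (∑ r, L1 L r x y * cartan L r i k x y)
          + ∑ r, b r x * cartan L r i k x y) := by
    simp only [Finset.mul_sum, ← Finset.sum_add_distrib, ← Finset.sum_sub_distrib]
    exact Finset.sum_congr rfl fun _ _ => by rw [diffTensor]; ring
  rw [e3, ← e1, e2, bCov]
  ring

include h h' hσ hb in
-- The same comparison for L̄_ij = e^σ L_ij; the factor e^σ cancels, and b does not occur
-- explicitly.
theorem L2_mul_diffTensor_add (hx : x ∈ U) (hy : y ≠ 0) (i j k : Fin n) :
    ∑ r, L2 L j r x y * Dxy r i k + ∑ r, L2 L i r x y * Dxy r j k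
      = σd σ k x * L2 L i j x y - ∑ r, L3 L i j r x y * contractMid Dxy y r k := by
  have s2 := h.smooth.L2 h.isOpen i j
  have e1 := h'.delta_L2 hx hy i j k
  have e4 : ∀ r, L3 (Lbar L σ b) i j r x y = Real.exp (σ x) * L3 L i j r x y := by
    intro r
    rw [L3, dy_eq_dirDeriv (h'.smooth.L2 h.isOpen i j) h.isOpen hx hy,
      dirDeriv_congr h.isOpen hx hy (fun x hx y hy => h.L2_Lbar hσ hb hx hy i j),
      h.dy_eq ((SmoothOffZero.ofBase hσ.exp).mul s2) hx hy, h.dy_exp_mul hσ s2 hx hy]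
    rfl
  rw [h.delta_Lbar h' hx hy,
    h.delta_congr (h'.smooth.L2 h.isOpen i j) (fun x hx y hy => h.L2_Lbar hσ hb hx hy i j) hx hy,
    h.delta_exp_mul hσ s2 hx hy, h.delta_L2 hx hy] at e1
  change _ - ∑ r, _ * L3 (Lbar L σ b) i j r x y = _ at e1
  simp only [h.L2_Lbar hσ hb hx hy, e4] at e1
  have e2 : ∑ r, contractMid Dxy y r k * (Real.exp (σ x) * L3 L i j r x y)
      = Real.exp (σ x) * ∑ r, L3 L i j r x y * contractMid Dxy y r k := by
    rw [Finset.mul_sum]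
    exact Finset.sum_congr rfl fun _ _ => by ring
  have e3 : ∀ a c, Real.exp (σ x) * ∑ r, L2 L a r x y * Dxy r c k
      = ∑ r, Real.exp (σ x) * L2 L a r x y * cartan (Lbar L σ b) r c k x y
        - Real.exp (σ x) * ∑ r, L2 L a r x y * cartan L r c k x y := by
    intro a c
    simp only [Finset.mul_sum, ← Finset.sum_sub_distrib]
    exact Finset.sum_congr rfl fun _ _ => by rw [diffTensor]; ring
  rw [e2] at e1
  refine mul_left_cancel₀ (Real.exp_ne_zero (σ x)) ?_
  rw [mul_add, e3, e3]
  linear_combination -e1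

include h h' hσ hb in
/-- `L_ir D^r_jk = H_ijk`, in terms of `D^r_0j`. -/
theorem L2_mul_diffTensor (hx : x ∈ U) (hy : y ≠ 0) (i j k : Fin n) :
    ∑ r, L2 L i r x y * Dxy r j k
      = (1 / 2) * ((∑ r, L3 L j k r x y * contractMid Dxy y r i)
        - (∑ r, L3 L i j r x y * contractMid Dxy y r k)
        - (∑ r, L3 L i k r x y * contractMid Dxy y r j)
        + σd σ j x * L2 L i k x y + σd σ k x * L2 L i j x y - σd σ i x * L2 L j k x y) := by
  -- As for Christoffel symbols: D is symmetric in its lower indices, so `e1` + `e2` - `e3` isolates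
  -- twice the sum sought.
  have e1 := h.L2_mul_diffTensor_add hσ hb h' hx hy i j k
  have e2 := h.L2_mul_diffTensor_add hσ hb h' hx hy i k j
  have e3 := h.L2_mul_diffTensor_add hσ hb h' hx hy j k i
  simp only [h.diffTensor_symm h' hx hy _ k j] at e2
  simp only [h.diffTensor_symm h' hx hy _ k i, h.diffTensor_symm h' hx hy _ j i] at e3
  linarith

include h h' hσ hb in
/-- `L̄_r D^r_jk = H_jk`, in terms of `D^r_0j`. -/
theorem L1_Lbar_mul_diffTensor_symm (hx : x ∈ U) (hy : y ≠ 0) (i k : Fin n) :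
    ∑ r, (Real.exp (σ x) * L1 L r x y + b r x) * Dxy r i k
      = E L b i k x y - (1 / 2) * Real.exp (σ x)
        * ((∑ r, L2 L i r x y * contractMid Dxy y r k)
          + (∑ r, L2 L k r x y * contractMid Dxy y r i) - σS L σ i k x y) := by
  -- The left side is symmetric in i and k, so it equals the average of the two right sides.
  have e1 := h.L1_Lbar_mul_diffTensor hσ hb h' hx hy i k
  have e2 := h.L1_Lbar_mul_diffTensor hσ hb h' hx hy k i
  simp only [h.diffTensor_symm h' hx hy _ k i] at e2
  rw [E, σS]
  linarith

include h h' hσ hb in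
/-- `L_ir D^r_0j = G_ij`, in terms of `D^r_00`. -/
theorem L2_mul_contractMid (hx : x ∈ U) (hy : y ≠ 0) (i j : Fin n) :
    ∑ r, L2 L i r x y * contractMid Dxy y r j
      = Real.exp (-σ x) * F L b i j x y
        - (1 / 2) * ∑ r, L3 L i j r x y * contractBoth Dxy y r
        + (1 / 2) * (σ0 σ x y * L2 L i j x y - μA L σ i j x y) := by
  -- The difference of `e1` and `e2` eliminates L̄_r D^r_ij and gives the skew part of L_ir D^r_0j;
  -- `e3` gives its symmetric part.
  have e1 := h.L1_Lbar_mul_diffTensor hσ hb h' hx hy i j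
  have e2 := h.L1_Lbar_mul_diffTensor hσ hb h' hx hy j i
  simp only [h.diffTensor_symm h' hx hy _ j i] at e2
  have e3 : ∑ r, L2 L j r x y * contractMid Dxy y r i + ∑ r, L2 L i r x y * contractMid Dxy y r j
      = σ0 σ x y * L2 L i j x y - ∑ r, L3 L i j r x y * contractBoth Dxy y r := by
    have : ∑ k, (∑ r, L2 L j r x y * Dxy r k i + ∑ r, L2 L i r x y * Dxy r k j) * y k
        = ∑ k, (σd σ k x * L2 L i j x y - ∑ r, L3 L i j r x y * contractMid Dxy y r k) * y k :=
      Finset.sum_congr rfl fun k _ => by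
        rw [← h.L2_mul_diffTensor_add hσ hb h' hx hy]
        simp only [h.diffTensor_symm h' hx hy _ k]
    simp only [add_mul, sub_mul, Finset.sum_add_distrib, Finset.sum_sub_distrib,
      ← sum_mul_contractMid, ← sum_mul_contractBoth] at this
    rw [this, σ0, Finset.sum_mul]
    congr 1
    exact Finset.sum_congr rfl fun _ _ => by ring
  have e4 : Real.exp (-σ x) * Real.exp (σ x) = 1 := by rw [← Real.exp_add]; simp
  rw [F, μA]
  linear_combination (1 / 2) * e3 + (1 / 2) * Real.exp (-σ x) * (e1 - e2)
    - (1 / 2) * (∑ r, L2 L i r x y * contractMid Dxy y r j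
      - ∑ r, L2 L j r x y * contractMid Dxy y r i
      - σd σ j x * L1 L i x y + σd σ i x * L1 L j x y) * e4

include h h' hσ hb in
/-- `L̄_r D^r_0j = G_j`, in terms of `D^r_00`. -/
theorem L1_Lbar_mul_contractMid (hx : x ∈ U) (hy : y ≠ 0) (k : Fin n) :
    ∑ r, (Real.exp (σ x) * L1 L r x y + b r x) * contractMid Dxy y r k
      = E0 L b k x y - (1 / 2) * Real.exp (σ x) * ∑ r, L2 L k r x y * contractBoth Dxy y r
        + (1 / 2) * Real.exp (σ x) * (σ0 σ x y * L1 L k x y + σd σ k x * L x y) := by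
  -- One of the two L_ir-terms vanishes on contraction because L_ir y^i = 0.
  have e1 : ∑ i, (∑ r, L2 L i r x y * contractMid Dxy y r k) * y i = 0 := by
    have : ∑ i, (∑ r, L2 L i r x y * contractMid Dxy y r k) * y i
        = ∑ r, (∑ i, L2 L i r x y * y i) * contractMid Dxy y r k := by
      simp only [Finset.sum_mul]
      rw [Finset.sum_comm]
      exact Finset.sum_congr rfl fun _ _ => Finset.sum_congr rfl fun _ _ => by ring
    rw [this]
    simp [h.L2_contract_left hx hy]
  have e2 : ∑ i, σS L σ i k x y * y i = σ0 σ x y * L1 L k x y + σd σ k x * L x y := by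
    rw [σ0, ← h.euler hx hy, Finset.mul_sum, Finset.sum_mul, ← Finset.sum_add_distrib]
    exact Finset.sum_congr rfl fun _ _ => by rw [σS]; ring
  have e3 : ∑ i, (E L b i k x y - (1 / 2) * Real.exp (σ x)
        * ((∑ r, L2 L i r x y * contractMid Dxy y r k)
          + (∑ r, L2 L k r x y * contractMid Dxy y r i) - σS L σ i k x y)) * y i
      = E0 L b k x y - (1 / 2) * Real.exp (σ x)
        * (∑ i, (∑ r, L2 L i r x y * contractMid Dxy y r k) * y i
          + ∑ i, (∑ r, L2 L k r x y * contractMid Dxy y r i) * y i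
          - ∑ i, σS L σ i k x y * y i) := by
    rw [E0, ← Finset.sum_add_distrib, ← Finset.sum_sub_distrib, Finset.mul_sum,
      ← Finset.sum_sub_distrib]
    exact Finset.sum_congr rfl fun _ _ => by ring
  rw [sum_mul_contractMid]
  simp only [h.L1_Lbar_mul_diffTensor_symm hσ hb h' hx hy]
  rw [e3, e1, e2, ← sum_mul_contractBoth]
  ring

include h h' hσ hb in
-- The step that closes the system: since L_ijr y^j = -L_ir, contracting `L2_mul_contractMid`
-- returns half of the unknown on the right. Moving it to the left doubles the remaining terms and
-- leaves no D there.
theorem L2_mul_contractBoth (hx : x ∈ U) (hy : y ≠ 0) (i : Fin n) :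
    ∑ r, L2 L i r x y * contractBoth Dxy y r
      = 2 * Real.exp (-σ x) * F0 L b i x y - L x y * σd σ i x + σ0 σ x y * L1 L i x y := by
  have e1 : ∑ j, (∑ r, L3 L i j r x y * contractBoth Dxy y r) * y j
      = -∑ r, L2 L i r x y * contractBoth Dxy y r := by
    have : ∑ j, (∑ r, L3 L i j r x y * contractBoth Dxy y r) * y j
        = ∑ r, (∑ j, L3 L i j r x y * y j) * contractBoth Dxy y r := by
      simp only [Finset.sum_mul]
      rw [Finset.sum_comm]
      exact Finset.sum_congr rfl fun _ _ => Finset.sum_congr rfl fun _ _ => by ring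
    rw [this]
    simp [h.L3_contract_mid hx hy]
  have e2 : ∑ j, μA L σ i j x y * y j = σd σ i x * L x y - σ0 σ x y * L1 L i x y := by
    rw [σ0, ← h.euler hx hy, Finset.mul_sum, Finset.sum_mul, ← Finset.sum_sub_distrib]
    exact Finset.sum_congr rfl fun _ _ => by rw [μA]; ring
  have e3 : ∑ j, (Real.exp (-σ x) * F L b i j x y
        - (1 / 2) * ∑ r, L3 L i j r x y * contractBoth Dxy y r
        + (1 / 2) * (σ0 σ x y * L2 L i j x y - μA L σ i j x y)) * y j
      = Real.exp (-σ x) * F0 L b i x y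
        - (1 / 2) * ∑ j, (∑ r, L3 L i j r x y * contractBoth Dxy y r) * y j
        + (1 / 2) * (σ0 σ x y * (∑ j, L2 L i j x y * y j) - ∑ j, μA L σ i j x y * y j) := by
    rw [F0, Finset.mul_sum (a := σ0 σ x y), ← Finset.sum_sub_distrib, Finset.mul_sum,
      Finset.mul_sum, Finset.mul_sum, ← Finset.sum_sub_distrib, ← Finset.sum_add_distrib]
    exact Finset.sum_congr rfl fun _ _ => by ring
  have e4 := sum_mul_contractBoth Dxy y fun r => L2 L i r x y
  simp only [h.L2_mul_contractMid hσ hb h' hx hy] at e4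
  rw [e3, e1, e2, h.L2_contract hx hy] at e4
  linarith

include h h' hσ hb in
theorem L1_Lbar_mul_contractBoth (hx : x ∈ U) (hy : y ≠ 0) :
    ∑ r, (Real.exp (σ x) * L1 L r x y + b r x) * contractBoth Dxy y r
      = E00 L b x y + Real.exp (σ x) * σ0 σ x y * L x y := by
  have e1 : ∑ k, (∑ r, L2 L k r x y * contractBoth Dxy y r) * y k = 0 := by
    have : ∑ k, (∑ r, L2 L k r x y * contractBoth Dxy y r) * y k
        = ∑ r, (∑ k, L2 L k r x y * y k) * contractBoth Dxy y r := by
      simp only [Finset.sum_mul]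
      rw [Finset.sum_comm]
      exact Finset.sum_congr rfl fun _ _ => Finset.sum_congr rfl fun _ _ => by ring
    rw [this]
    simp [h.L2_contract_left hx hy]
  have e2 : ∑ k, E0 L b k x y * y k = E00 L b x y := by
    simp only [E0, E00, Finset.sum_mul]
    exact Finset.sum_comm
  have e3 : ∑ k, (E0 L b k x y
        - (1 / 2) * Real.exp (σ x) * ∑ r, L2 L k r x y * contractBoth Dxy y r
        + (1 / 2) * Real.exp (σ x) * (σ0 σ x y * L1 L k x y + σd σ k x * L x y)) * y k
      = ∑ k, E0 L b k x y * y k - (1 / 2) * Real.exp (σ x)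
          * ∑ k, (∑ r, L2 L k r x y * contractBoth Dxy y r) * y k
        + (1 / 2) * Real.exp (σ x) * (σ0 σ x y * (∑ k, L1 L k x y * y k)
          + (∑ k, σd σ k x * y k) * L x y) := by
    rw [Finset.mul_sum (a := σ0 σ x y), Finset.sum_mul (a := L x y), ← Finset.sum_add_distrib,
      Finset.mul_sum, Finset.mul_sum, ← Finset.sum_sub_distrib, ← Finset.sum_add_distrib]
    exact Finset.sum_congr rfl fun _ _ => by ring
  rw [sum_mul_contractBoth]
  simp only [h.L1_Lbar_mul_contractMid hσ hb h' hx hy]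
  rw [e3, e1, e2, h.euler hx hy, ← σ0]
  ring

include h h' hσ hb in
theorem contractBoth_diffTensor (hx : x ∈ U) (hy : y ≠ 0) (i : Fin n) :
    contractBoth Dxy y i = D00 L σ b i x y := by
  have hL := h.pos x hx y hy
  have hL' := h'.pos x hx y hy
  rw [h.eq_of_contractions hL' hx hy (h.L2_mul_contractBoth hσ hb h' hx hy)
    (h.L1_Lbar_mul_contractBoth hσ hb h' hx hy) i]
  have e1 : ∑ r, gInv L i r x y * L1 L r x y = Lup L i x y := by
    have := h.sum_gInv_mul_g hx hy (fun j => y j) i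
    simp only [h.g_contract hx hy] at this
    rw [Lup, eq_div_iff hL.ne', ← this, Finset.sum_mul]
    exact Finset.sum_congr rfl fun _ _ => by ring
  have e2 : ∑ r, gInv L i r x y * (2 * Real.exp (-σ x) * F0 L b r x y - L x y * σd σ r x
        + σ0 σ x y * L1 L r x y)
      = 2 * Real.exp (-σ x) * F0Up L b i x y - L x y * σUp L σ i x y
        + σ0 σ x y * Lup L i x y := by
    rw [← e1, F0Up, σUp, Finset.mul_sum, Finset.mul_sum, Finset.mul_sum,
      ← Finset.sum_sub_distrib, ← Finset.sum_add_distrib]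
    refine Finset.sum_congr rfl fun r _ => ?_
    rw [h.gInv_symm hx hy r i]
    ring
  have e3 : ∑ r, bUp L b r x y * L1 L r x y = (∑ r, b r x * y r) / L x y := by
    rw [eq_div_iff hL.ne']
    have : ∀ j, ∑ r, gInv L j r x y * (L x y * L1 L r x y) = y j := fun j => by
      simp only [← h.g_contract hx hy]
      exact h.sum_gInv_mul_g hx hy (fun j => y j) j
    simp only [← this, bUp, Finset.mul_sum, Finset.sum_mul]
    rw [Finset.sum_comm]
    refine Finset.sum_congr rfl fun r _ => Finset.sum_congr rfl fun s _ => ?_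
    rw [h.gInv_symm hx hy r s]
    ring
  have e4 : ∑ r, bUp L b r x y * (2 * Real.exp (-σ x) * F0 L b r x y - L x y * σd σ r x
        + σ0 σ x y * L1 L r x y)
      = 2 * Real.exp (-σ x) * Fb0 L b x y - L x y * σb L σ b x y
        + σ0 σ x y * ((∑ r, b r x * y r) / L x y) := by
    rw [← e3, Fb0, σb, Finset.mul_sum, Finset.mul_sum, Finset.mul_sum,
      ← Finset.sum_sub_distrib, ← Finset.sum_add_distrib]
    exact Finset.sum_congr rfl fun _ _ => by ring
  -- Substituting β = L̄ - e^σ L cancels L σ_0 L^i and leaves the term (L/L̄) 2L e^σ σ_0 L^i.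
  have e5 : ∑ r, b r x * y r = Lbar L σ b x y - Real.exp (σ x) * L x y := by
    rw [Lbar]
    ring
  rw [e2, e4, e5, D00]
  field_simp
  ring

include h h' hσ hb in
theorem contractMid_diffTensor_eq (hx : x ∈ U) (hy : y ≠ 0) (i j : Fin n) :
    contractMid Dxy y i j = D0 L σ b i j x y := by
  have e1 : ∀ i, ∑ r, L2 L i r x y * contractMid Dxy y r j = G2 L σ b i j x y := fun i => by
    rw [h.L2_mul_contractMid hσ hb h' hx hy]
    simp only [h.contractBoth_diffTensor hσ hb h' hx hy, G2]
  have e2 : ∑ r, (Real.exp (σ x) * L1 L r x y + b r x) * contractMid Dxy y r j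
      = G1 L σ b j x y := by
    rw [h.L1_Lbar_mul_contractMid hσ hb h' hx hy]
    simp only [h.contractBoth_diffTensor hσ hb h' hx hy, G1]
  exact h.eq_of_contractions (h'.pos x hx y hy) hx hy e1 e2 i

include h h' hσ hb in
theorem diffTensor_eq (hx : x ∈ U) (hy : y ≠ 0) (i j k : Fin n) :
    Dxy i j k = Dexpr L σ b i j k x y := by
  have e1 : ∀ i, ∑ r, L2 L i r x y * Dxy r j k = H3 L σ b i j k x y := fun i => by
    rw [h.L2_mul_diffTensor hσ hb h' hx hy]
    simp only [h.contractMid_diffTensor_eq hσ hb h' hx hy, H3]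
  have e2 : ∑ r, (Real.exp (σ x) * L1 L r x y + b r x) * Dxy r j k = H2 L σ b j k x y := by
    rw [h.L1_Lbar_mul_diffTensor_symm hσ hb h' hx hy]
    simp only [h.contractMid_diffTensor_eq hσ hb h' hx hy, H2]
  exact h.eq_of_contractions (h'.pos x hx y hy) hx hy e1 e2 i

end Difference

end IsLocalFinsler

end BetaConformalChange

/-! ### Passage from the manifold to local coordinates. -/

section Manifold

variable {n : ℕ} {M : Type*} [TopologicalSpace M] [ChartedSpace (Rn n) M]

theorem inCoord_betaConformalChange (L : TangentBundle (𝓡 n) M → ℝ) (σ : M → ℝ)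
    (b : ∀ p : M, TangentSpace (𝓡 n) p →L[ℝ] ℝ) (c : OpenPartialHomeomorph M (Rn n)) :
    inCoord c (betaConformalChange σ b L) = Lbar (inCoord c L) (σ ∘ c.symm) (formCoord c b) := by
  funext x y
  simp only [inCoord, betaConformalChange, Lbar, tangentVec, Function.comp_apply]
  congr 1
  let T : Rn n →L[ℝ] ℝ := (b (c.symm x)).comp (mfderiv (𝓡 n) (𝓡 n) c.symm x)
  change T y = ∑ i, T (EuclideanSpace.single i 1) * y i
  conv_lhs => rw [fibre_eq_sum y, map_sum]
  exact Finset.sum_congr rfl fun i _ => by rw [map_smul, smul_eq_mul, mul_comm]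

theorem inCoord_smul {L : TangentBundle (𝓡 n) M → ℝ} (hL : IsFinslerMetric L)
    (c : OpenPartialHomeomorph M (Rn n)) (x y : Rn n) {t : ℝ} (ht : 0 < t) :
    inCoord c L x (t • y) = t * inCoord c L x y := by
  have h1 : tangentVec c x (t • y)
      = ⟨c.symm x, t • (mfderiv (𝓡 n) (𝓡 n) c.symm x y : TangentSpace (𝓡 n) (c.symm x))⟩ := by
    rw [tangentVec]
    congr 1
    exact map_smul (mfderiv (𝓡 n) (𝓡 n) c.symm x) t y
  rw [inCoord, h1, hL.homogeneous _ _ t ht]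
  rfl

/-- The differential of the inverse chart is invertible; positivity of L on nonzero tangent vectors
thus passes to nonzero coordinate vectors. -/
theorem mfderiv_symm_ne_zero {c : OpenPartialHomeomorph M (Rn n)}
    (hc : c ∈ IsManifold.maximalAtlas (𝓡 n) ∞ M) {x : Rn n} (hx : x ∈ c.target) {y : Rn n}
    (hy : y ≠ 0) : (mfderiv (𝓡 n) (𝓡 n) c.symm x y : TangentSpace (𝓡 n) (c.symm x)) ≠ 0 := by
  have hd : c.MDifferentiable (𝓡 n) (𝓡 n) :=
    ⟨(contMDiffOn_of_mem_maximalAtlas hc).mdifferentiableOn (by simp),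
      (contMDiffOn_symm_of_mem_maximalAtlas hc).mdifferentiableOn (by simp)⟩
  intro h0
  have h1 := hd.comp_symm_deriv hx
  have h2 := DFunLike.congr_fun h1 y
  refine hy (h2.symm.trans ?_)
  change mfderiv (𝓡 n) (𝓡 n) c (c.symm x) (mfderiv (𝓡 n) (𝓡 n) c.symm x y) = 0
  rw [h0]
  exact map_zero _

theorem IsFinslerMetric.isLocalFinsler {L : TangentBundle (𝓡 n) M → ℝ} (hL : IsFinslerMetric L)
    {c : OpenPartialHomeomorph M (Rn n)} (hc : c ∈ IsManifold.maximalAtlas (𝓡 n) ∞ M) :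
    IsLocalFinsler c.target (inCoord c L) where
  isOpen := c.open_target
  smooth := hL.smooth c hc
  pos _ hx _ hy := hL.pos _ _ (mfderiv_symm_ne_zero hc hx hy)
  homogeneous _ _ _ ht := inCoord_smul hL c _ _ ht
  det_ne_zero x hx y hy := (hL.posDef c hc x hx y hy).det_pos.ne'

end Manifold

end Finsler

theorem theoremA {n : ℕ} {M : Type*} [TopologicalSpace M] [ChartedSpace (Rn n) M]
    [IsManifold (𝓡 n) ∞ M]
    (L : TangentBundle (𝓡 n) M → ℝ) (hL : Finsler.IsFinslerMetric L)
    (σ : M → ℝ) (hσ : ContMDiff (𝓡 n) 𝓘(ℝ, ℝ) ∞ σ)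
    (b : ∀ p : M, TangentSpace (𝓡 n) p →L[ℝ] ℝ) (hb : Finsler.IsSmoothOneForm b)
    (hLbar : Finsler.IsFinslerMetric (Finsler.betaConformalChange σ b L))
    (c : OpenPartialHomeomorph M (Rn n)) (hc : c ∈ IsManifold.maximalAtlas (𝓡 n) ∞ M)
    (x : Rn n) (hx : x ∈ c.target) (y : Rn n) (hy : y ≠ 0) :
    (∀ i j k, Finsler.cartanDiff L (Finsler.betaConformalChange σ b L) c i j k x y
      = Finsler.Dexpr (Finsler.inCoord c L) (σ ∘ c.symm) (Finsler.formCoord c b) i j k x y) ∧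
    (∀ r j, ∑ i, Finsler.cartanDiff L (Finsler.betaConformalChange σ b L) c r i j x y * y i
      = Finsler.D0 (Finsler.inCoord c L) (σ ∘ c.symm) (Finsler.formCoord c b) r j x y) ∧
    (∀ r, ∑ i, ∑ j,
        Finsler.cartanDiff L (Finsler.betaConformalChange σ b L) c r i j x y * y i * y j
      = Finsler.D00 (Finsler.inCoord c L) (σ ∘ c.symm) (Finsler.formCoord c b) r x y) := by
  have h := hL.isLocalFinsler hc
  have h' := hLbar.isLocalFinsler hc
  rw [Finsler.inCoord_betaConformalChange] at h'
  have hσ' : ContDiffOn ℝ ∞ (σ ∘ c.symm) c.target :=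
    (hσ.comp_contMDiffOn (contMDiffOn_symm_of_mem_maximalAtlas hc)).contDiffOn
  have hb' := hb c hc
  have hD : ∀ i j k, Finsler.cartanDiff L (Finsler.betaConformalChange σ b L) c i j k x y
      = Finsler.diffTensor (Finsler.inCoord c L) (σ ∘ c.symm)
        (Finsler.formCoord c b) x y i j k := by
    intro i j k
    rw [Finsler.cartanDiff, Finsler.inCoord_betaConformalChange]
    rfl
  simp only [hD]
  refine ⟨h.diffTensor_eq hσ' hb' h' hx hy, h.contractMid_diffTensor_eq hσ' hb' h' hx hy,
    fun r => ?_⟩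
  -- `contractBoth` sums over the first lower index on the inside, so the double sum must be
  -- interchanged.
  rw [← h.contractBoth_diffTensor hσ' hb' h' hx hy, Finset.sum_comm]
  simp only [Finsler.contractBoth, Finsler.contractMid, Finset.sum_mul]
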